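/- **Conventions.** A \emph{two-way nondeterministic pushdown automaton} (2NPDA) over a finite alphabet $\Sigma$ has finite sets $Q$ of states and $\Gamma$ of stack symbols, an initial state $q_0$, a set $F\subseteq Q$ of final states, an end-of-stack symbol $Z_0\in\Gamma$, and a finite transition relation $\delta\subseteq Q\times(\Sigma\cup\{\lhd,\rhd\})\times\Gamma\times Q\times\Gamma^*\times\{-1,0,+1\}$. Here $\lhd,\rhd\notin\Sigma$ are the left and right endmarkers. A transition $(q,a,Z,q',u,d)$ applies in state $q$ when $a$ is scanned and $Z$ is on top of the stack; it changes the state to $q'$, replaces $Z$ by $u$ (first letter on top), and moves the head by $d$, never off the tape. If $Z=Z_0$, then $u=vZ_0$ with $Z_0$ not occurring in $v$; if $Z\ne Z_0$, then $Z_0$ does not occur in $u$. The tape holds $\lhd w\rhd$. The word $w\in\Sigma^*$ belongs to $L(\mathcal A)$ if from state $q_0$, with the head on $\lhd$ and stack $Z_0$, the automaton can reach a state in $F$ with the head on $\rhd$ and stack $Z_0$. The Dyck-2 language is generated by $S\to SS\mid (S)\mid [S]\mid\varepsilon$. Let $\Sigma_0=\{\,(\,,\,)\,,\,[\,,\,]\,,\vdash,1,-,\#\}$.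 Consider words $u=\vdash B_1\vdash B_2\cdots\vdash B_n$ over $\Sigma_0$, where each block $B_i$ is a (possibly empty) list, separated by $\#$, of words $\ell o$ with $\ell$ one of the four brackets and $o=1^k$ ($k\ge 0$) or $o=-1^m$ ($m\ge1$); the \emph{offset} of $\ell o$ is $k$, respectively $-m$. The word $u$ encodes a directed edge-labelled graph (parallel edges allowed) on vertices $1,\dots,n$: each $\ell o$ in $B_i$ with offset $k$ gives an edge labelled $\ell$ from $i$ to the position reached from $i$ by $|k|$ unit moves on $0,1,\dots,n+1$, starting to the right if $k>0$ and to the left if $k<0$, where the direction is reversed at $0$ and at $n+1$ (the endmarkers, each counting as one virtual vertex). If that position is $0$ or $n+1$, there is no such edge. Let $L_0$ be the set of words $u$ of this form with $n\ge1$ whose graph has a (possibly empty) walk from $1$ to $n$ labelled by a Dyck-2 word. **Theorem.** There exists a 2NPDA $\mathcal A_0$ over $\Sigma_0$ with $L(\mathcal A_0)=L_0$ and with the following property: for every 2NPDA $\mathcal A$ over every finite alphabet $\Sigma$ there is a homomorphism $h:\Sigma^*\to\Sigma_0^*$ such that, for all $w\in\Sigma^+$, $$w\in L(\mathcal A)\iff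 h(w)\in L(\mathcal A_0).$$ Moreover, $h$ can be chosen together with a number $k$, depending only on $\mathcal A$, such that for every $w\in\Sigma^+$ the word $h(w)$ encodes a graph of the above form with at most $k|w|$ vertices, at most $k$ outgoing edges at each vertex, and all offsets at most $k$ in absolute value. -/

import Mathlib

/-! ### Two-way nondeterministic pushdown automata -/

/-- Contents of a tape cell: a letter of the input word or one of the two endmarkers. -/
inductive TapeCell (α : Type) : Type
  | leftEnd : TapeCell α
  | letter (a : α) : TapeCell α
  | rightEnd : TapeCell α

/-- A two-way nondeterministic pushdown automaton (2NPDA) over the input alphabet `α`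
(not counting the endmarkers). `(q, a, Z, q', u, d) ∈ trans` means: in state `q`, scanning `a`,
with `Z` on top of the stack, the automaton may go to state `q'`, replace `Z` by the string `u`
(the first symbol of `u` becomes the top), and move its head by `d ∈ {-1, 0, 1}`. -/
structure TwoNPDA (α : Type) where
  State : Type
  StackSym : Type
  finite_state : Finite State
  finite_stackSym : Finite StackSym
  start : State
  final : Set State
  /-- the end-of-stack symbol -/
  bottom : StackSym
  trans : Set (State × TapeCell α × StackSym × State × List StackSym × SignType)
  finite_trans : trans.Finite
  /-- the end-of-stack symbol is never removed: a transition that reads it puts it back, below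
  whatever else is pushed -/
  trans_bottom : ∀ q a q' u d, (q, a, bottom, q', u, d) ∈ trans →
    ∃ v, u = v ++ [bottom] ∧ bottom ∉ v
  /-- no other transition pushes the end-of-stack symbol -/
  trans_other : ∀ q a Z q' u d, (q, a, Z, q', u, d) ∈ trans → Z ≠ bottom → bottom ∉ u

namespace TwoNPDA

variable {α : Type}

/-- The tape: the input word between the two endmarkers. -/
def tape (w : List α) : List (TapeCell α) :=
  TapeCell.leftEnd :: (w.map TapeCell.letter ++ [TapeCell.rightEnd])

/-- A configuration on a fixed tape; the top of the stack is the head of the list. -/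
structure Config (A : TwoNPDA α) where
  state : A.State
  pos : ℕ
  stack : List A.StackSym

/-- One step on the input `w`; the head must stay on the tape. -/
def Step (A : TwoNPDA α) (w : List α) (c c' : A.Config) : Prop :=
  ∃ (a : TapeCell α) (Z : A.StackSym) (rest u : List A.StackSym) (d : SignType),
    (c.state, a, Z, c'.state, u, d) ∈ A.trans ∧
    (tape w)[c.pos]? = some a ∧
    c.stack = Z :: rest ∧
    c'.stack = u ++ rest ∧
    (c'.pos : ℤ) = (c.pos : ℤ) + (d : ℤ) ∧
    c'.pos < (tape w).length

/-- Acceptance: from the start state on the left endmarker with only the end-of-stack symbol on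
the stack, the automaton can reach a final state on the right endmarker with the same stack. -/
def Accepts (A : TwoNPDA α) (w : List α) : Prop :=
  ∃ q ∈ A.final,
    Relation.ReflTransGen (A.Step w)
      ⟨A.start, 0, [A.bottom]⟩ ⟨q, w.length + 1, [A.bottom]⟩

/-- The language of all accepted words. -/
def language (A : TwoNPDA α) : Language α := {w | A.Accepts w}

end TwoNPDA

/-! ### Dyck-2 reachability -/

/-- Brackets of two kinds. -/
inductive Br : Type
  | openRound
  | closeRound
  | openSquare
  | closeSquare

/-- The Dyck-2 language, by the grammar `S → S S | ( S ) | [ S ] | ε`. -/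
inductive IsDyckTwo : List Br → Prop
  | nil : IsDyckTwo []
  | append {u v : List Br} : IsDyckTwo u → IsDyckTwo v → IsDyckTwo (u ++ v)
  | round {u : List Br} : IsDyckTwo u →
      IsDyckTwo (Br.openRound :: (u ++ [Br.closeRound]))
  | square {u : List Br} : IsDyckTwo u →
      IsDyckTwo (Br.openSquare :: (u ++ [Br.closeSquare]))

/-- `IsWalk E s u t`: the directed graph with labelled edges `E` has a walk from `s` to `t` whose
sequence of edge labels is `u`. -/
inductive IsWalk {V : Type} (E : V → Br → V → Prop) : V → List Br → V → Prop
  | nil (v : V) : IsWalk E v [] v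
  | cons {x y z : V} {b : Br} {u : List Br} :
      E x b y → IsWalk E y u z → IsWalk E x (b :: u) z

/-- Dyck-2 reachability: some walk from `s` to `t` is labelled by a Dyck-2 word. -/
def DyckTwoReach {V : Type} (E : V → Br → V → Prop) (s t : V) : Prop :=
  ∃ u, IsDyckTwo u ∧ IsWalk E s u t

/-! ### Dyck-2 reachability with relative edge addresses -/

/-- A graph with relative edge addresses: the list of its vertices in order, each given by the
list of its outgoing edges, and each edge given by its label and its offset. -/
abbrev RelGraph : Type := List (List (Br × ℤ))

/-- One move of a head over `n` vertices at positions `1, …, n`, with the endmarkers at `0` and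
`n + 1`. The Boolean is the direction (`true` for right). The head reverses its direction when it
stands on the endmarker that it would otherwise run past. -/
def scrollStep (n : ℕ) : ℕ × Bool → ℕ × Bool
  | (p, true) => if n + 1 ≤ p then (n, false) else (p + 1, true)
  | (p, false) => if p = 0 then (1, true) else (p - 1, false)

/-- The position reached from position `i` by an offset `k`: the head makes `|k|` moves, starting
to the right if `k` is positive and to the left if `k` is negative. Each endmarker counts as one
virtual vertex, and the head is reflected there. -/
def destination (n i : ℕ) (k : ℤ) : ℕ :=
  ((scrollStep n)^[k.natAbs] (i, decide (0 ≤ k))).1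

namespace RelGraph

/-- The labelled edges. Position `i + 1` belongs to the vertex with index `i`. An edge whose
destination is a virtual vertex is not an edge of the graph. -/
def Edge (G : RelGraph) (i : Fin G.length) (b : Br) (j : Fin G.length) : Prop :=
  ∃ k : ℤ, (b, k) ∈ G.get i ∧ destination G.length (i + 1) k = j + 1

/-- There is at least one vertex, and the last vertex is Dyck-2 reachable from the first one. -/
def YesInstance (G : RelGraph) : Prop :=
  ∃ hn : 0 < G.length,
    DyckTwoReach G.Edge ⟨0, hn⟩ ⟨G.length - 1, Nat.sub_lt hn Nat.one_pos⟩

/-- `G` has at most `N` vertices, and width at most `k`: every vertex has at most `k` outgoing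
edges and every offset is at most `k` in absolute value. -/
def Bounded (G : RelGraph) (N k : ℕ) : Prop :=
  G.length ≤ N ∧ ∀ B ∈ G, B.length ≤ k ∧ ∀ e ∈ B, e.2.natAbs ≤ k

end RelGraph

/-- The fixed eight-letter alphabet: four brackets, the vertex marker, the digit `1`, the minus
sign, and the separator between edges. -/
inductive HardSym : Type
  | bracket (b : Br)
  | vmark
  | one
  | minus
  | sep

/-- An offset in signed unary: `1^k` for `k ≥ 0`, and `-1^m` for `k = -m < 0`. -/
def encodeOffset (k : ℤ) : List HardSym :=
  (if k < 0 then [HardSym.minus] else []) ++ List.replicate k.natAbs HardSym.one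

/-- An edge: its label followed by its offset. -/
def encodeEdge (e : Br × ℤ) : List HardSym :=
  HardSym.bracket e.1 :: encodeOffset e.2

/-- A vertex: the vertex marker followed by the outgoing edges, separated by separators. -/
def encodeVertex (B : List (Br × ℤ)) : List HardSym :=
  HardSym.vmark :: List.intercalate [HardSym.sep] (B.map encodeEdge)

/-- A graph: the codes of its vertices, in order. -/
def RelGraph.encode (G : RelGraph) : List HardSym :=
  G.flatMap encodeVertex

/-- The set of all codes of yes-instances. -/
def relDyckTwoLanguage : Language HardSym :=
  {u | ∃ G : RelGraph, u = G.encode ∧ G.YesInstance}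

/-! ### Stack semantics of Dyck words -/

/-! A word is Dyck-2 exactly if, executed as pushes and pops, it leads from the empty stack to the
empty stack (`isDyckTwo_iff_acts`). So Dyck-2 reachability is ordinary reachability between pairs of
a vertex and a stack of open brackets (`dyckTwoReach_iff`): a labelled graph is itself a pushdown
machine with two stack symbols, and all comparisons reduce to one-step simulations.

Hardness. Coding stack symbols by a prefix code over the two bracket kinds turns each transition of
a 2NPDA into a fixed word of brackets, and the automaton into a finite program that executes one
bracket at a time (`exists_bracket_program`). Its graph of pairs (state, head position) is local on
the tape, so each letter can be replaced by a block of vertices of constant size whose edges have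
bounded offsets. The block depends on the letter alone, which gives a homomorphism; but then it
cannot know whether it is the first or the last one and has to simulate an endmarker. Reflection
supplies this information: an address in a missing neighbour block is folded back into the same
block, in mirror order. Entry points from the left and from the right are numbered in opposite
directions, so that the mirror image of the entry point of a state is the endmarker vertex of the
same state (`destination_left`, `destination_right`, `yesInstance_graph_iff`).

Membership. The automaton checks the syntax with a finite automaton, then guesses a walk and keeps
the open brackets on its stack. To follow an edge it copies the unary offset onto the stack as
marks, returns to the vertex, and removes one mark per vertex marker passed; turning at the tape
ends realizes the reflection. `walkInv_of_step` gives soundness and `runs_edge` completeness.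
Soundness is shown for every nonempty graph with the given code, so unique decoding is not needed.
-/

/-- The opening bracket of a kind: round for `true`, square for `false`. -/
def Br.opening : Bool → Br
  | true => Br.openRound
  | false => Br.openSquare

/-- The closing bracket of a kind: round for `true`, square for `false`. -/
def Br.closing : Bool → Br
  | true => Br.closeRound
  | false => Br.closeSquare

/-- The effect of a bracket on a stack of open brackets. -/
inductive Br.Act : Br → List Bool → List Bool → Prop
  | push (k : Bool) (s : List Bool) : Br.Act (Br.opening k) s (k :: s)
  | pop (k : Bool) (s : List Bool) : Br.Act (Br.closing k) (k :: s) s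

/-- The effect of a word of brackets on a stack of open brackets. -/
inductive Acts : List Br → List Bool → List Bool → Prop
  | nil (s : List Bool) : Acts [] s s
  | cons {b : Br} {u : List Br} {s s' s'' : List Bool} :
      b.Act s s' → Acts u s' s'' → Acts (b :: u) s s''

instance : Finite Br := Finite.of_injective
  (fun b : Br => match b with
    | .openRound => (0 : Fin 4) | .closeRound => 1 | .openSquare => 2 | .closeSquare => 3)
  (by intro a b; cases a <;> cases b <;> simp)

lemma Br.act_opening_iff {k : Bool} {s s' : List Bool} :
    (Br.opening k).Act s s' ↔ s' = k :: s := by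
  constructor
  · intro h
    generalize hb : Br.opening k = b at h
    cases h with
    | push k' s => cases k <;> cases k' <;> simp_all [Br.opening]
    | pop k' s => cases k <;> cases k' <;> simp_all [Br.opening, Br.closing]
  · rintro rfl
    exact .push k s

lemma Br.act_closing_iff {k : Bool} {s s' : List Bool} :
    (Br.closing k).Act s s' ↔ s = k :: s' := by
  constructor
  · intro h
    generalize hb : Br.closing k = b at h
    cases h with
    | push k' s => cases k <;> cases k' <;> simp_all [Br.opening, Br.closing]
    | pop k' s => cases k <;> cases k' <;> simp_all [Br.closing]
  · rintro rfl
    exact .pop k s'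

lemma Acts.nil_iff {s s' : List Bool} : Acts [] s s' ↔ s' = s := by
  constructor
  · intro h; cases h; rfl
  · rintro rfl; exact .nil _

lemma Acts.cons_iff {b : Br} {u : List Br} {s s'' : List Bool} :
    Acts (b :: u) s s'' ↔ ∃ s', b.Act s s' ∧ Acts u s' s'' := by
  constructor
  · intro h; cases h with | cons h1 h2 => exact ⟨_, h1, h2⟩
  · rintro ⟨s', h1, h2⟩; exact .cons h1 h2

lemma Acts.append_iff {u v : List Br} {s s'' : List Bool} :
    Acts (u ++ v) s s'' ↔ ∃ s', Acts u s s' ∧ Acts v s' s'' := by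
  induction u generalizing s with
  | nil => simp [Acts.nil_iff]
  | cons b u ih =>
    simp only [List.cons_append, Acts.cons_iff, ih]
    constructor
    · rintro ⟨t, h1, t', h2, h3⟩; exact ⟨t', ⟨t, h1, h2⟩, h3⟩
    · rintro ⟨t', ⟨t, h1, h2⟩, h3⟩; exact ⟨t, h1, t', h2, h3⟩

lemma IsDyckTwo.wrap {u : List Br} (h : IsDyckTwo u) (k : Bool) :
    IsDyckTwo (Br.opening k :: (u ++ [Br.closing k])) := by
  cases k
  · exact .square h
  · exact .round h

lemma Acts.wrap {u : List Br} (h : ∀ s, Acts u s s) (k : Bool) (s : List Bool) :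
    Acts (Br.opening k :: (u ++ [Br.closing k])) s s :=
  .cons (.push k s) (Acts.append_iff.2 ⟨_, h _, .cons (.pop k s) (.nil s)⟩)

lemma IsDyckTwo.acts {u : List Br} (h : IsDyckTwo u) : ∀ s, Acts u s s := by
  induction h with
  | nil => exact fun s => .nil s
  | append _ _ h1 h2 => exact fun s => Acts.append_iff.2 ⟨s, h1 s, h2 s⟩
  | round _ h => exact Acts.wrap h true
  | square _ h => exact Acts.wrap h false

/-- Dyck words interleaved with the closing brackets of a stack. -/
def ClosesStack : List Bool → List Br → Prop
  | [], u => IsDyckTwo u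
  | k :: s, u => ∃ d v, IsDyckTwo d ∧ u = d ++ Br.closing k :: v ∧ ClosesStack s v

lemma ClosesStack.append {s : List Bool} {d u : List Br} (hd : IsDyckTwo d)
    (h : ClosesStack s u) : ClosesStack s (d ++ u) := by
  cases s with
  | nil => exact IsDyckTwo.append hd h
  | cons k s =>
    obtain ⟨e, v, he, rfl, hv⟩ := h
    exact ⟨d ++ e, v, IsDyckTwo.append hd he, by simp, hv⟩

/-- Induction on the word from its left end. After a push of `k`, the remaining word splits at the
bracket closing that `k`, and wrapping the Dyck word before it gives a new Dyck factor; a pop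
contributes an empty Dyck factor. The case of the empty stack is the hard half of
`isDyckTwo_iff_acts`. -/
lemma Acts.closesStack {u : List Br} {s t : List Bool} (h : Acts u s t) (ht : t = []) :
    ClosesStack s u := by
  induction h with
  | nil s => subst ht; exact .nil
  | cons h1 _ ih =>
    cases h1 with
    | push k s =>
      obtain ⟨d, v, hd, rfl, hv⟩ := ih ht
      simpa using ClosesStack.append (hd.wrap k) hv
    | pop k s => exact ⟨[], _, .nil, rfl, ih ht⟩

lemma isDyckTwo_iff_acts {u : List Br} : IsDyckTwo u ↔ Acts u [] [] :=
  ⟨fun h => h.acts [], fun h => h.closesStack rfl⟩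

/-- One step of a walk that keeps a stack of open brackets. -/
def StackStep {V : Type} (E : V → Br → V → Prop) (c c' : V × List Bool) : Prop :=
  ∃ b, E c.1 b c'.1 ∧ b.Act c.2 c'.2

lemma IsWalk.reflTransGen {V : Type} {E : V → Br → V → Prop} {x y : V} {u : List Br}
    (h : IsWalk E x u y) {s s' : List Bool} (hs : Acts u s s') :
    Relation.ReflTransGen (StackStep E) (x, s) (y, s') := by
  induction h generalizing s with
  | nil v => rw [Acts.nil_iff.1 hs]
  | cons hE _ ih =>
    obtain ⟨t, h1, h2⟩ := Acts.cons_iff.1 hs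
    exact .head ⟨_, hE, h1⟩ (ih h2)

lemma exists_isWalk_of_reflTransGen {V : Type} {E : V → Br → V → Prop}
    {c c' : V × List Bool} (h : Relation.ReflTransGen (StackStep E) c c') :
    ∃ u, IsWalk E c.1 u c'.1 ∧ Acts u c.2 c'.2 := by
  induction h using Relation.ReflTransGen.head_induction_on with
  | refl => exact ⟨[], .nil _, .nil _⟩
  | head h1 _ ih =>
    obtain ⟨b, hE, hb⟩ := h1
    obtain ⟨u, hw, hu⟩ := ih
    exact ⟨b :: u, .cons hE hw, .cons hb hu⟩

/-- Removes the labels of whole walks from the argument: from here on only single steps with a stack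
have to be matched. -/
lemma dyckTwoReach_iff {V : Type} {E : V → Br → V → Prop} {x y : V} :
    DyckTwoReach E x y ↔ Relation.ReflTransGen (StackStep E) (x, []) (y, []) := by
  constructor
  · rintro ⟨u, hu, hw⟩
    exact hw.reflTransGen (isDyckTwo_iff_acts.1 hu)
  · intro h
    obtain ⟨u, hw, hu⟩ := exists_isWalk_of_reflTransGen h
    exact ⟨u, isDyckTwo_iff_acts.2 hu, hw⟩

/-- A simulation between labelled graphs lifts to walks with a stack. -/
lemma reflTransGen_stackStep_of_simulation {V V' : Type} {E : V → Br → V → Prop}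
    {E' : V' → Br → V' → Prop} {R : V → V' → Prop}
    (hsim : ∀ x x', R x x' → ∀ b y, E x b y → ∃ y', E' x' b y' ∧ R y y')
    {c d : V × List Bool} (h : Relation.ReflTransGen (StackStep E) c d)
    {x' : V'} (hx : R c.1 x') :
    ∃ y', R d.1 y' ∧ Relation.ReflTransGen (StackStep E') (x', c.2) (y', d.2) := by
  induction h with
  | refl => exact ⟨x', hx, .refl⟩
  | tail _ h1 ih =>
    obtain ⟨y', hy, hr⟩ := ih
    obtain ⟨b, hE, hb⟩ := h1
    obtain ⟨z', hz, hR⟩ := hsim _ _ hy b _ hE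
    exact ⟨z', hR, hr.tail ⟨b, hz, hb⟩⟩

/-! ### From automata to bracket programs -/

/-- The configuration graph of a two-way program `T` over brackets on the input `w`. -/
def tapeGraph {α S : Type} (T : S → TapeCell α → Br → S → SignType → Prop) (w : List α)
    (x : S × ℕ) (b : Br) (y : S × ℕ) : Prop :=
  ∃ a d, T x.1 a b y.1 d ∧ (TwoNPDA.tape w)[x.2]? = some a ∧
    (y.2 : ℤ) = (x.2 : ℤ) + (d : ℤ) ∧ y.2 < (TwoNPDA.tape w).length

namespace TwoNPDA

variable {α : Type}

lemma length_tape (w : List α) : (tape w).length = w.length + 2 := by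
  simp [tape]

lemma getElem?_tape_zero (w : List α) : (tape w)[0]? = some .leftEnd := rfl

lemma getElem?_tape_succ (w : List α) {i : ℕ} (h : i < w.length) :
    (tape w)[i + 1]? = some (.letter w[i]) := by
  simp [tape, List.getElem?_append_left, h]

lemma getElem?_tape_last (w : List α) : (tape w)[w.length + 1]? = some .rightEnd := by
  simp [tape]

lemma getElem?_tape_eq_leftEnd {w : List α} {i : ℕ} (h : (tape w)[i]? = some .leftEnd) :
    i = 0 := by
  by_contra hi
  obtain ⟨j, rfl⟩ := Nat.exists_eq_succ_of_ne_zero hi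
  have hlt := (List.getElem?_eq_some_iff.1 h).1
  rw [length_tape] at hlt
  rcases Nat.lt_or_ge j w.length with hj | hj
  · simp [getElem?_tape_succ w hj] at h
  · obtain rfl : j = w.length := by omega
    simp [getElem?_tape_last] at h

lemma getElem?_tape_eq_rightEnd {w : List α} {i : ℕ} (h : (tape w)[i]? = some .rightEnd) :
    i = w.length + 1 := by
  have hlt := (List.getElem?_eq_some_iff.1 h).1
  rw [length_tape] at hlt
  rcases i with _ | j
  · simp [getElem?_tape_zero] at h
  · rcases Nat.lt_or_ge j w.length with hj | hj
    · simp [getElem?_tape_succ w hj] at h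
    · omega

lemma getElem?_tape_eq_letter {w : List α} {i : ℕ} {a : α}
    (h : (tape w)[i]? = some (.letter a)) : ∃ j, i = j + 1 ∧ w[j]? = some a := by
  have hlt := (List.getElem?_eq_some_iff.1 h).1
  rw [length_tape] at hlt
  rcases i with _ | j
  · simp [getElem?_tape_zero] at h
  · rcases Nat.lt_or_ge j w.length with hj | hj
    · exact ⟨j, rfl, by simpa [getElem?_tape_succ w hj, hj] using h⟩
    · obtain rfl : j = w.length := by omega
      simp [getElem?_tape_last] at h

end TwoNPDA

/-! ### A prefix code for stack symbols over two kinds of brackets. -/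

/-- The stack code of the symbol with number `n`. -/
def symStack (n : ℕ) : List Bool := List.replicate n true ++ [false]

/-- The brackets that push the symbol with number `n`. -/
def pushSym (n : ℕ) : List Br := Br.openSquare :: List.replicate n Br.openRound

/-- The brackets that pop the symbol with number `n`. -/
def popSym (n : ℕ) : List Br := List.replicate n Br.closeRound ++ [Br.closeSquare]

/-- The stack code of a word of symbols numbered by `f`. -/
def stackCode {Γ : Type} (f : Γ → ℕ) (γ : List Γ) : List Bool := γ.flatMap fun Z => symStack (f Z)

/-- The brackets that push a word of symbols numbered by `f`. -/
def pushWord {Γ : Type} (f : Γ → ℕ) (γ : List Γ) : List Br :=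
  γ.reverse.flatMap fun Z => pushSym (f Z)

lemma acts_pushSym_iff {n : ℕ} {s s' : List Bool} :
    Acts (pushSym n) s s' ↔ s' = symStack n ++ s := by
  have h : ∀ n s, Acts (List.replicate n Br.openRound) s s' ↔ s' = List.replicate n true ++ s := by
    intro n
    induction n with
    | zero => simp [Acts.nil_iff]
    | succ n ih =>
      intro s
      rw [List.replicate_succ, Acts.cons_iff, List.replicate_succ']
      simp [show Br.openRound = Br.opening true from rfl, Br.act_opening_iff]
      simpa [show Br.openRound = Br.opening true from rfl] using ih (true :: s)
  rw [pushSym, Acts.cons_iff]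
  simp [show Br.openSquare = Br.opening false from rfl, Br.act_opening_iff, h, symStack]

/-- The equivalence makes the pop word a test: it can be executed only if the code of the symbol
with number `n` is on top, and otherwise the run gets stuck. -/
lemma acts_popSym_iff {n : ℕ} {s s' : List Bool} :
    Acts (popSym n) s s' ↔ s = symStack n ++ s' := by
  induction n generalizing s with
  | zero =>
    simp [popSym, symStack, Acts.cons_iff, Acts.nil_iff,
      show Br.closeSquare = Br.closing false from rfl, Br.act_closing_iff]
  | succ n ih =>
    rw [popSym, List.replicate_succ, List.cons_append, Acts.cons_iff]
    change (∃ t, _ ∧ Acts (popSym n) t s') ↔ _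
    simp [ih, show Br.closeRound = Br.closing true from rfl, Br.act_closing_iff, symStack,
      List.replicate_succ]

/-- The number is the count of `true` before the first `false`, so no code is a proper prefix of
another. -/
lemma symStack_append_inj {n m : ℕ} {s t : List Bool} (h : symStack n ++ s = symStack m ++ t) :
    n = m ∧ s = t := by
  induction n generalizing m with
  | zero => cases m <;> simp_all [symStack, List.replicate_succ]
  | succ n ih =>
    cases m with
    | zero => simp [symStack, List.replicate_succ] at h
    | succ m =>
      have := @ih m (by simpa [symStack, List.replicate_succ] using h)
      exact ⟨by rw [this.1], this.2⟩

lemma stackCode_append {Γ : Type} (f : Γ → ℕ) (γ γ' : List Γ) :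
    stackCode f (γ ++ γ') = stackCode f γ ++ stackCode f γ' := by
  simp [stackCode]

lemma stackCode_cons {Γ : Type} (f : Γ → ℕ) (Z : Γ) (γ : List Γ) :
    stackCode f (Z :: γ) = symStack (f Z) ++ stackCode f γ := rfl

lemma acts_pushWord_iff {Γ : Type} (f : Γ → ℕ) {γ : List Γ} {s s' : List Bool} :
    Acts (pushWord f γ) s s' ↔ s' = stackCode f γ ++ s := by
  induction γ generalizing s' with
  | nil => simp [pushWord, stackCode, Acts.nil_iff]
  | cons Z γ ih =>
    have : pushWord f (Z :: γ) = pushWord f γ ++ pushSym (f Z) := by simp [pushWord]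
    rw [this, Acts.append_iff]
    simp [ih, acts_pushSym_iff, stackCode_cons]

lemma stackCode_eq_symStack_append {Γ : Type} {f : Γ → ℕ} (hf : f.Injective) {γ : List Γ} {Z : Γ}
    {s : List Bool} (h : stackCode f γ = symStack (f Z) ++ s) :
    ∃ γ', γ = Z :: γ' ∧ s = stackCode f γ' := by
  cases γ with
  | nil => simp [stackCode, symStack] at h
  | cons Y γ =>
    obtain ⟨h1, h2⟩ := symStack_append_inj (stackCode_cons f Y γ ▸ h)
    exact ⟨γ, by rw [hf h1], h2.symm⟩

/-! ### Simulation of an automaton by a bracket program. -/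

namespace TwoNPDA

variable {α : Type}

/-- The bracket program of an automaton. Its control states consist of the brackets that are still
to be executed and of the state to be entered then; `none` is an additional state, in which the
program starts and ends. -/
inductive Program (A : TwoNPDA α) (f : A.StackSym → ℕ) :
    List Br × Option A.State → TapeCell α → Br → List Br × Option A.State → SignType → Prop
  | run (b : Br) (u : List Br) (x : Option A.State) (a : TapeCell α) :
      Program A f (b :: u, x) a b (u, x) 0
  | move {q : A.State} {a : TapeCell α} {Z : A.StackSym} {q' : A.State} {γ : List A.StackSym}
      {d : SignType} {b : Br} {u : List Br} :
      (q, a, Z, q', γ, d) ∈ A.trans → popSym (f Z) ++ pushWord f γ = b :: u →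
      Program A f ([], some q) a b (u, some q') d
  | enter {b : Br} {u : List Br} : pushSym (f A.bottom) = b :: u →
      Program A f ([], none) .leftEnd b (u, some A.start) 0
  | exit {q : A.State} {b : Br} {u : List Br} : q ∈ A.final → popSym (f A.bottom) = b :: u →
      Program A f ([], some q) .rightEnd b (u, none) 0

lemma Program.reflTransGen_run {A : TwoNPDA α} {f : A.StackSym → ℕ} {w : List α} {p : ℕ}
    (hp : p < (tape w).length) (x : Option A.State) {u : List Br} {s s' : List Bool}
    (h : Acts u s s') :
    Relation.ReflTransGen (StackStep (tapeGraph (Program A f) w)) (((u, x), p), s)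
      ((([], x), p), s') := by
  induction h with
  | nil => exact .refl
  | cons hb _ ih =>
    exact .head ⟨_, ⟨_, 0, .run _ _ x _, List.getElem?_eq_getElem hp, by simp, hp⟩, hb⟩ ih

/-- The head move is attached to the first bracket of the block and the rest is executed in place,
so the block must be nonempty. Pop and push words of symbols are never empty. -/
lemma Program.reflTransGen_block {A : TwoNPDA α} {f : A.StackSym → ℕ} {w : List α} {p p' : ℕ}
    {a : TapeCell α} {d : SignType} {x x' : Option A.State} {v : List Br}
    (hv : v ≠ []) (hT : ∀ b u, v = b :: u → Program A f ([], x) a b (u, x') d)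
    (ha : (tape w)[p]? = some a) (hd : (p' : ℤ) = (p : ℤ) + (d : ℤ))
    (hp : p' < (tape w).length) {s s' : List Bool} (h : Acts v s s') :
    Relation.ReflTransGen (StackStep (tapeGraph (Program A f) w)) ((([], x), p), s)
      ((([], x'), p'), s') := by
  obtain ⟨b, u, rfl⟩ := List.exists_cons_of_ne_nil hv
  obtain ⟨t, hb, hu⟩ := Acts.cons_iff.1 h
  exact .head ⟨b, ⟨a, d, hT b u rfl, ha, hd, hp⟩, hb⟩ (reflTransGen_run hp x' hu)

lemma Program.reflTransGen_of_step {A : TwoNPDA α} (f : A.StackSym → ℕ) {w : List α}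
    {c c' : A.Config} (h : A.Step w c c') :
    Relation.ReflTransGen (StackStep (tapeGraph (Program A f) w))
      ((([], some c.state), c.pos), stackCode f c.stack)
      ((([], some c'.state), c'.pos), stackCode f c'.stack) := by
  obtain ⟨a, Z, rest, γ, d, ht, ha, hs, hs', hd, hp⟩ := h
  refine reflTransGen_block (v := popSym (f Z) ++ pushWord f γ) (by simp [popSym])
    (fun b u hv => .move ht hv) ha hd hp (Acts.append_iff.2 ⟨stackCode f rest, ?_, ?_⟩)
  · rw [acts_popSym_iff, hs, stackCode_cons]
  · rw [acts_pushWord_iff, hs', stackCode_append]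

/-- The invariant of the runs of the bracket program: it holds of a configuration if whatever
the pending brackets lead to is a configuration reachable by the automaton. -/
def Program.Sound (A : TwoNPDA α) (f : A.StackSym → ℕ) (w : List α)
    (c : ((List Br × Option A.State) × ℕ) × List Bool) : Prop :=
  ∀ s, Acts c.1.1.1 c.2 s →
    match c.1.1.2 with
    | some q => ∃ γ, s = stackCode f γ ∧
        Relation.ReflTransGen (A.Step w) ⟨A.start, 0, [A.bottom]⟩ ⟨q, c.1.2, γ⟩
    | none => (c.1.2 = 0 ∧ s = []) ∨ (c.1.2 = w.length + 1 ∧ (s = [] → A.Accepts w))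

/-- Prefixing the bracket just executed to the pending word does not change where it leads, so a
`run` step inherits the invariant directly. The other rules start with no pending brackets; there
the invariant describes the current stack itself, and the whole new word is evaluated at once. -/
lemma Program.sound_of_stackStep {A : TwoNPDA α} {f : A.StackSym → ℕ} (hf : f.Injective)
    {w : List α} {c c' : ((List Br × Option A.State) × ℕ) × List Bool} (h : Sound A f w c)
    (hs : StackStep (tapeGraph (Program A f) w) c c') : Sound A f w c' := by
  obtain ⟨⟨⟨u, x⟩, p⟩, t⟩ := c
  obtain ⟨⟨⟨u', x'⟩, p'⟩, t'⟩ := c'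
  obtain ⟨b, ⟨a, d, hT, ha, hd, hp⟩, hb⟩ := hs
  dsimp only at hT ha hd hp hb
  intro s hu'
  dsimp only at hu'
  have hu : Acts (b :: u') t s := .cons hb hu'
  cases hT with
  | run =>
    obtain rfl : p' = p := by simpa using hd
    exact h s hu
  | move ht hv =>
    obtain ⟨γ, rfl, hr⟩ := h t (.nil t)
    rw [← hv, Acts.append_iff] at hu
    obtain ⟨t₁, h1, h2⟩ := hu
    obtain ⟨γ', rfl, rfl⟩ := stackCode_eq_symStack_append hf (acts_popSym_iff.1 h1)
    exact ⟨_, by rw [(acts_pushWord_iff f).1 h2, stackCode_append],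
      hr.tail ⟨a, _, γ', _, d, ht, ha, rfl, rfl, hd, hp⟩⟩
  | enter hv =>
    obtain rfl : p' = p := by simpa using hd
    obtain rfl := getElem?_tape_eq_leftEnd ha
    have := h t (.nil t)
    dsimp only at this
    -- The program can start only from the empty stack: after an exit it stands on the right
    -- endmarker and cannot read the left one again.
    obtain ⟨-, rfl⟩ | ⟨h0, -⟩ := this
    · rw [← hv, acts_pushSym_iff] at hu
      exact ⟨[A.bottom], by simp [hu, stackCode], .refl⟩
    · omega
  | exit hq hv =>
    obtain rfl : p' = p := by simpa using hd
    obtain rfl := getElem?_tape_eq_rightEnd ha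
    obtain ⟨γ, rfl, hr⟩ := h t (.nil t)
    rw [← hv] at hu
    obtain ⟨γ', rfl, rfl⟩ := stackCode_eq_symStack_append hf (acts_popSym_iff.1 hu)
    refine Or.inr ⟨rfl, fun h0 => ⟨_, hq, ?_⟩⟩
    cases γ' with
    | nil => exact hr
    | cons Z γ' => simp [stackCode, symStack] at h0

lemma accepts_iff_program {A : TwoNPDA α} {f : A.StackSym → ℕ} (hf : f.Injective) (w : List α) :
    A.Accepts w ↔ Relation.ReflTransGen (StackStep (tapeGraph (Program A f) w))
      ((([], none), 0), []) ((([], none), w.length + 1), []) := by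
  constructor
  · rintro ⟨q, hq, hr⟩
    have h1 : Relation.ReflTransGen (StackStep (tapeGraph (Program A f) w))
        ((([], none), 0), []) ((([], some A.start), 0), stackCode f [A.bottom]) :=
      Program.reflTransGen_block (v := pushSym (f A.bottom)) (by simp [pushSym])
        (fun b u hv => .enter hv) (getElem?_tape_zero w) (by simp) (by simp [length_tape])
        (by simp [acts_pushSym_iff, stackCode])
    have h2 : ∀ c c' : A.Config, Relation.ReflTransGen (A.Step w) c c' →
        Relation.ReflTransGen (StackStep (tapeGraph (Program A f) w))
          ((([], some c.state), c.pos), stackCode f c.stack)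
          ((([], some c'.state), c'.pos), stackCode f c'.stack) := by
      intro c c' h
      induction h with
      | refl => exact .refl
      | tail _ hs ih => exact ih.trans (Program.reflTransGen_of_step f hs)
    have h3 : Relation.ReflTransGen (StackStep (tapeGraph (Program A f) w))
        ((([], some q), w.length + 1), stackCode f [A.bottom])
        ((([], none), w.length + 1), []) :=
      Program.reflTransGen_block (v := popSym (f A.bottom)) (by simp [popSym])
        (fun b u hv => .exit hq hv) (getElem?_tape_last w) (by simp) (by simp [length_tape])
        (by simp [acts_popSym_iff, stackCode])
    exact (h1.trans (h2 _ _ hr)).trans h3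
  · intro h
    have h0 : Program.Sound A f w ((([], none), 0), []) := by
      intro s hs
      exact Or.inl ⟨rfl, Acts.nil_iff.1 hs⟩
    have h1 : Program.Sound A f w ((([], none), w.length + 1), []) := by
      generalize ((([], none), w.length + 1), []) = c at h
      induction h with
      | refl => exact h0
      | tail _ hs ih => exact Program.sound_of_stackStep hf ih hs
    obtain ⟨h2, -⟩ | ⟨-, h2⟩ := h1 [] (.nil [])
    · exact absurd h2 (Nat.succ_ne_zero _)
    · exact h2 rfl

/-- Every automaton is equivalent to a bracket program with finitely many states that starts on the
left endmarker and ends on the right endmarker, both times in state `0` with the empty stack. -/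
theorem exists_bracket_program (A : TwoNPDA α) :
    ∃ (N : ℕ) (T : Fin (N + 1) → TapeCell α → Br → Fin (N + 1) → SignType → Prop),
      ∀ w, A.Accepts w ↔ Relation.ReflTransGen (StackStep (tapeGraph T w))
        ((0, 0), []) ((0, w.length + 1), []) := by
  have := A.finite_state
  have := A.finite_stackSym
  have := Fintype.ofFinite A.StackSym
  let f : A.StackSym → ℕ := fun Z => Fintype.equivFin A.StackSym Z
  have hf : f.Injective := Fin.val_injective.comp (Fintype.equivFin A.StackSym).injective
  obtain ⟨K, hK⟩ : ∃ K, ∀ t ∈ A.trans,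
      (popSym (f t.2.2.1) ++ pushWord f t.2.2.2.2.1).length ≤ K := by
    obtain ⟨K, hK⟩ := (A.finite_trans.image fun t =>
      (popSym (f t.2.2.1) ++ pushWord f t.2.2.2.2.1).length).bddAbove
    exact ⟨K, fun t ht => hK ⟨t, ht, rfl⟩⟩
  -- Pending words are suffixes of words that belong to transitions, of length at most `K`, or of
  -- the words pushing and popping the bottom symbol, of length `f A.bottom + 1`. States with longer
  -- pending words can be discarded.
  let M := K + (f A.bottom + 1)
  have hclosed : ∀ x a b y d, Program A f x a b y d → x.1.length ≤ M → y.1.length ≤ M := by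
    intro x a b y d h hx
    cases h with
    | run => simp only [List.length_cons] at hx; simp only; omega
    | move ht hv =>
      have := hK _ ht
      simp only [hv, List.length_cons] at this
      simp only [M]; omega
    | enter hv =>
      have := congrArg List.length hv
      simp [pushSym] at this
      simp only [M]; omega
    | exit _ hv =>
      have := congrArg List.length hv
      simp [popSym] at this
      simp only [M]; omega
  let S := {x : List Br × Option A.State // x.1.length ≤ M}
  have : Finite S := by
    have h1 := (List.finite_length_le Br M).prod (Set.finite_univ (α := Option A.State))
    exact (h1.subset fun x hx => ⟨hx, trivial⟩ :
      {x : List Br × Option A.State | x.1.length ≤ M}.Finite).to_subtype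
  let hub : S := ⟨([], none), Nat.zero_le _⟩
  obtain ⟨n, ⟨e⟩⟩ := Finite.exists_equiv_fin S
  obtain ⟨N, rfl⟩ : ∃ N, n = N + 1 := Nat.exists_eq_succ_of_ne_zero (by
    rintro rfl; exact (e hub).elim0)
  -- The swap gives number `0` to the state in which the program starts and ends; the block layout
  -- places its endmarker vertices first and last.
  let e' : S ≃ Fin (N + 1) := e.trans (Equiv.swap (e hub) 0)
  have he : e'.symm 0 = hub := by simp [e']
  let T : Fin (N + 1) → TapeCell α → Br → Fin (N + 1) → SignType → Prop :=
    fun i a b j d => Program A f (e'.symm i).1 a b (e'.symm j).1 d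
  refine ⟨N, T, fun w => (accepts_iff_program hf w).trans ⟨fun h => ?_, fun h => ?_⟩⟩
  · obtain ⟨⟨i, p⟩, ⟨h1, h2⟩, h3⟩ := reflTransGen_stackStep_of_simulation
      (E' := tapeGraph T w) (R := fun x x' => x.1 = (e'.symm x'.1).1 ∧ x.2 = x'.2)
      (by
        rintro ⟨x, p⟩ ⟨i, p'⟩ ⟨hx, hp⟩ b ⟨y, q⟩ ⟨a, d, hT, ha⟩
        dsimp only at hx hp hT ha
        subst hx hp
        have hy := hclosed _ _ _ _ _ hT (e'.symm i).2
        exact ⟨(e' ⟨y, hy⟩, q), ⟨a, d, by simpa [T] using hT, ha⟩, by simp⟩)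
      h (x' := (0, 0)) ⟨by simp [he, hub], rfl⟩
    dsimp only at h1 h2
    subst h2
    obtain rfl : i = 0 := e'.symm.injective (Subtype.ext (by rw [he]; exact h1.symm))
    exact h3
  · obtain ⟨⟨x, p⟩, ⟨h1, h2⟩, h3⟩ := reflTransGen_stackStep_of_simulation
      (E' := tapeGraph (Program A f) w) (R := fun x x' => (e'.symm x.1).1 = x'.1 ∧ x.2 = x'.2)
      (by
        rintro ⟨i, p⟩ ⟨x, p'⟩ ⟨hx, hp⟩ b ⟨j, q⟩ ⟨a, d, hT, ha⟩
        dsimp only at hx hp hT ha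
        subst hx hp
        exact ⟨((e'.symm j).1, q), ⟨a, d, hT, ha⟩, rfl, rfl⟩)
      h (x' := (([], none), 0)) ⟨by simp [he, hub], rfl⟩
    dsimp only at h1 h2
    subst h1 h2
    simpa [he, hub] using h3

end TwoNPDA

/-! ### From bracket programs to graphs with relative addresses -/

lemma scrollStep_iterate_true {n i t : ℕ} (h : i + t ≤ n + 1) :
    (scrollStep n)^[t] (i, true) = (i + t, true) := by
  induction t with
  | zero => rfl
  | succ t ih =>
    rw [Function.iterate_succ_apply', ih (by omega)]
    simp only [scrollStep]
    rw [if_neg (by omega)]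
    rfl

lemma scrollStep_iterate_false {n i t : ℕ} (h : t ≤ i) :
    (scrollStep n)^[t] (i, false) = (i - t, false) := by
  induction t with
  | zero => rfl
  | succ t ih =>
    rw [Function.iterate_succ_apply', ih (by omega)]
    simp only [scrollStep]
    rw [if_neg (by omega), Nat.sub_sub]

lemma destination_of_mem_Icc {n i : ℕ} {k : ℤ} {t : ℕ} (ht : (i : ℤ) + k = t)
    (htn : t ≤ n + 1) : destination n i k = t := by
  unfold destination
  by_cases hk : 0 ≤ k
  · rw [decide_eq_true hk, scrollStep_iterate_true (by omega)]
    simp only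
    omega
  · rw [decide_eq_false hk, scrollStep_iterate_false (by omega)]
    simp only
    omega

lemma destination_reflect_right {n i : ℕ} {k : ℤ} {t : ℕ} (hi : i ≤ n + 1)
    (ht : (i : ℤ) + k = n + 1 + (t + 1 : ℕ)) (htn : t ≤ n) : destination n i k = n - t := by
  unfold destination
  -- The moves split into those up to the endmarker, one that turns there, and `t` moves back; in
  -- the iterate the rightmost summand acts first.
  rw [decide_eq_true (by omega), show k.natAbs = t + (1 + (n + 1 - i)) by omega,
    Function.iterate_add_apply, Function.iterate_add_apply, scrollStep_iterate_true (by omega),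
    show i + (n + 1 - i) = n + 1 by omega]
  simp only [Function.iterate_one, scrollStep, le_refl, if_true]
  rw [scrollStep_iterate_false htn]

lemma destination_reflect_left {n i : ℕ} {k : ℤ} {t : ℕ}
    (ht : (i : ℤ) + k = -(t + 1 : ℕ)) (htn : t ≤ n) : destination n i k = t + 1 := by
  unfold destination
  rw [decide_eq_false (by omega), show k.natAbs = t + (1 + i) by omega,
    Function.iterate_add_apply, Function.iterate_add_apply, scrollStep_iterate_false le_rfl]
  simp only [Function.iterate_one, scrollStep, Nat.sub_self, if_true]
  rw [scrollStep_iterate_true (by omega), Nat.add_comm]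

lemma getElem?_flatMap_of_length_eq {α β : Type} {f : α → List β} {m : ℕ}
    (hf : ∀ a, (f a).length = m) (w : List α) (c : ℕ) {p : ℕ} (hp : p < m) :
    (w.flatMap f)[c * m + p]? = w[c]?.bind fun a => (f a)[p]? := by
  induction w generalizing c with
  | nil => simp
  | cons a w ih =>
    rw [List.flatMap_cons]
    cases c with
    | zero => simp [List.getElem?_append_left, hf, hp]
    | succ c =>
      have h : (c + 1) * m + p = m + (c * m + p) := by ring
      rw [List.getElem?_append_right (by rw [hf]; omega), hf, h, Nat.add_sub_cancel_left, ih]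
      simp

/-! ### The block of a letter, and endmarkers simulated by reflection. -/

namespace BracketProgram

variable {α : Type} {N : ℕ}

/-- The edges at local position `p` of the block of the letter `a`. A block has four vertices for
every state `i`: at `4 * i` for the left endmarker, at `4 * i + 1` and `4 * (N - i) + 2` for the
letter, entered from the left or from the right, and at `4 * (N - i) + 3` for the right endmarker.
Reflection at an end of the tape turns an address of an entry point in a missing neighbour block
into that of the vertex for the endmarker. -/
def LocalEdge (T : Fin (N + 1) → TapeCell α → Br → Fin (N + 1) → SignType → Prop) (a : α)
    (p : ℕ) (b : Br) (k : ℤ) : Prop :=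
  ∃ i j : Fin (N + 1),
    ((p : ℤ) = 4 * i ∧
      ((T i .leftEnd b j 0 ∧ p + k = 4 * j) ∨ (T i .leftEnd b j 1 ∧ p + k = 4 * j + 1))) ∨
    ((p : ℤ) = 4 * (N - i) + 3 ∧
      ((T i .rightEnd b j 0 ∧ p + k = 4 * (N - j) + 3) ∨
        (T i .rightEnd b j (-1) ∧ p + k = 4 * j + 1))) ∨
    (((p : ℤ) = 4 * i + 1 ∨ (p : ℤ) = 4 * (N - i) + 2) ∧
      ((T i (.letter a) b j 0 ∧ p + k = 4 * j + 1) ∨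
        (T i (.letter a) b j 1 ∧ p + k = 4 * (N + 1) + (4 * j + 1)) ∨
        (T i (.letter a) b j (-1) ∧ p + k = 4 * (N - j) + 2 - 4 * (N + 1))))

/-- All edges with offsets of absolute value at most `8 * (N + 1)`. -/
noncomputable def edgeBox (N : ℕ) : Finset (Br × ℤ) :=
  ((Set.finite_univ (α := Br)).prod
    (Set.finite_Icc (-(8 * (N + 1) : ℤ)) (8 * (N + 1)))).toFinset

lemma mem_edgeBox {e : Br × ℤ} : e ∈ edgeBox N ↔ e.2.natAbs ≤ 8 * (N + 1) := by
  simp only [edgeBox, Set.Finite.mem_toFinset, Set.mem_prod, Set.mem_univ, true_and, Set.mem_Icc]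
  omega

open scoped Classical in
/-- The list of the edges at local position `p` of the block of the letter `a`. -/
noncomputable def edges (T : Fin (N + 1) → TapeCell α → Br → Fin (N + 1) → SignType → Prop)
    (a : α) (p : ℕ) : List (Br × ℤ) :=
  ((edgeBox N).filter fun e => LocalEdge T a p e.1 e.2).toList

/-- The block of a letter. -/
noncomputable def block (T : Fin (N + 1) → TapeCell α → Br → Fin (N + 1) → SignType → Prop)
    (a : α) : RelGraph :=
  (List.range (4 * (N + 1))).map (edges T a)

/-- The graph of a program and an input word. -/
noncomputable def graph (T : Fin (N + 1) → TapeCell α → Br → Fin (N + 1) → SignType → Prop)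
    (w : List α) : RelGraph :=
  w.flatMap (block T)

variable {T : Fin (N + 1) → TapeCell α → Br → Fin (N + 1) → SignType → Prop}

/-- Restriction to the finite box loses nothing: sources lie in the block and unreflected targets in
it or in one of its two neighbours, so every offset is within twice the block length. -/
lemma mem_edges {a : α} {p : ℕ} {b : Br} {k : ℤ} :
    (b, k) ∈ edges T a p ↔ LocalEdge T a p b k := by
  simp only [edges, Finset.mem_toList, Finset.mem_filter, mem_edgeBox, and_iff_right_iff_imp]
  rintro ⟨i, j, h⟩
  have := i.2
  have := j.2
  rcases h with ⟨h, ⟨-, h'⟩ | ⟨-, h'⟩⟩ | ⟨h, ⟨-, h'⟩ | ⟨-, h'⟩⟩ |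
    ⟨h | h, ⟨-, h'⟩ | ⟨-, h'⟩ | ⟨-, h'⟩⟩ <;> omega

lemma length_block (a : α) : (block T a).length = 4 * (N + 1) := by
  simp [block]

lemma length_graph (w : List α) : (graph T w).length = w.length * (4 * (N + 1)) := by
  simp [graph, List.length_flatMap, length_block]

/-- One constant serves all three bounds: `8 * (N + 1)` exceeds the block length and bounds the
offsets, and the size of the box bounds the number of edges at a vertex. -/
lemma bounded_graph (w : List α) :
    (graph T w).Bounded ((8 * (N + 1) + (edgeBox N).card) * w.length)
      (8 * (N + 1) + (edgeBox N).card) := by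
  classical
  refine ⟨?_, fun B hB => ?_⟩
  · rw [length_graph, Nat.mul_comm]
    exact Nat.mul_le_mul_right _ (by omega)
  · simp only [graph, block, List.mem_flatMap, List.mem_map] at hB
    obtain ⟨a, -, p, -, rfl⟩ := hB
    constructor
    · rw [edges, Finset.length_toList]
      exact (Finset.card_filter_le _ _).trans (Nat.le_add_left _ _)
    · intro e he
      rw [edges, Finset.mem_toList, Finset.mem_filter, mem_edgeBox] at he
      exact he.1.trans (Nat.le_add_right _ _)

lemma edge_iff {w : List α} {c p : ℕ} (hc : c < w.length) (hp : p < 4 * (N + 1))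
    {v v' : Fin (graph T w).length} (hv : (v : ℕ) = c * (4 * (N + 1)) + p) {b : Br} :
    (graph T w).Edge v b v' ↔ ∃ k, LocalEdge T w[c] p b k ∧
      destination (w.length * (4 * (N + 1))) (c * (4 * (N + 1)) + p + 1) k = v' + 1 := by
  have h := getElem?_flatMap_of_length_eq (length_block (T := T)) w c hp
  have h' : (graph T w).get v = edges T w[c] p := by
    have : (graph T w)[(v : ℕ)]? = some (edges T w[c] p) := by
      rw [hv]
      change (w.flatMap (block T))[_]? = _
      rw [h]
      simp [hc, block, hp]
    rw [List.get_eq_getElem]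
    exact (List.getElem?_eq_some_iff.1 this).2
  simp only [RelGraph.Edge, h', mem_edges, hv, length_graph]

/-- The local position `p` in block `c` stands for state `x.1` at tape position `x.2`, for an input
of length `l`. -/
def Stands (l c p : ℕ) (x : Fin (N + 1) × ℕ) : Prop :=
  ((p : ℤ) = 4 * x.1 ∧ c = 0 ∧ x.2 = 0) ∨
  ((p : ℤ) = 4 * (N - x.1) + 3 ∧ c + 1 = l ∧ x.2 = l + 1) ∨
  (((p : ℤ) = 4 * x.1 + 1 ∨ (p : ℤ) = 4 * (N - x.1) + 2) ∧ x.2 = c + 1)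

/-- The vertex with index `v` stands for state `x.1` at tape position `x.2`. -/
def Rel (l : ℕ) (v : ℕ) (x : Fin (N + 1) × ℕ) : Prop :=
  ∃ c p, c < l ∧ p < 4 * (N + 1) ∧ v = c * (4 * (N + 1)) + p ∧ Stands l c p x

lemma Rel.lt {l v : ℕ} {x : Fin (N + 1) × ℕ} (h : Rel l v x) : v < l * (4 * (N + 1)) := by
  obtain ⟨c, p, hc, hp, rfl, -⟩ := h
  have := Nat.mul_le_mul_right (4 * (N + 1)) (Nat.succ_le_of_lt hc)
  rw [Nat.succ_mul] at this
  omega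

lemma destination_stay {l c p p' : ℕ} {k : ℤ} (hc : c < l) (hp' : p' < 4 * (N + 1))
    (hk : (p : ℤ) + k = p') {x : Fin (N + 1) × ℕ} (h : Stands l c p' x) :
    ∃ v, Rel l v x ∧
      destination (l * (4 * (N + 1))) (c * (4 * (N + 1)) + p + 1) k = v + 1 := by
  have hR : Rel l (c * (4 * (N + 1)) + p') x := ⟨c, p', hc, hp', rfl, h⟩
  have := hR.lt
  refine ⟨_, hR, destination_of_mem_Icc ?_ (by omega)⟩
  push_cast
  linarith

/-- If a next block exists, its entry point for `j` is hit directly. In the last block the address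
overshoots the virtual right vertex by `4 * j + 1`, and folding it back gives local position `4 * (N
- j) + 3`, the right endmarker vertex of `j`. -/
lemma destination_right {l c p : ℕ} {k : ℤ} (hc : c < l) (hp : p < 4 * (N + 1))
    {j : Fin (N + 1)} (hk : (p : ℤ) + k = 4 * (N + 1) + (4 * j + 1)) :
    ∃ v, Rel l v (j, c + 2) ∧
      destination (l * (4 * (N + 1))) (c * (4 * (N + 1)) + p + 1) k = v + 1 := by
  have hj := j.2
  by_cases hl : c + 1 < l
  · have hR : Rel l ((c + 1) * (4 * (N + 1)) + (4 * j + 1)) (j, c + 2) :=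
      ⟨c + 1, 4 * j + 1, hl, by omega, rfl, Or.inr (Or.inr ⟨Or.inl (by simp), rfl⟩)⟩
    have := hR.lt
    refine ⟨_, hR, destination_of_mem_Icc ?_ (by omega)⟩
    push_cast
    linarith
  · obtain rfl : l = c + 1 := by omega
    have hR : Rel (c + 1) (c * (4 * (N + 1)) + (4 * (N - j) + 3)) (j, c + 2) :=
      ⟨c, 4 * (N - j) + 3, hc, by omega, rfl, Or.inr (Or.inl ⟨by simp only; omega, rfl, rfl⟩)⟩
    have e : (c + 1) * (4 * (N + 1)) = c * (4 * (N + 1)) + 4 * (N + 1) := Nat.succ_mul _ _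
    refine ⟨_, hR, ?_⟩
    rw [destination_reflect_right (t := 4 * j) (by omega) ?_ (by omega)]
    · omega
    · rw [e]
      push_cast
      linarith

/-- Mirror image of `destination_right`: because entry points from the right are numbered backwards,
the address folded at the left end is `4 * j`, the left endmarker vertex of `j`. -/
lemma destination_left {l c p : ℕ} {k : ℤ} (hc : c < l)
    {j : Fin (N + 1)} (hk : (p : ℤ) + k = 4 * (N - j) + 2 - 4 * (N + 1)) :
    ∃ v, Rel l v (j, c) ∧
      destination (l * (4 * (N + 1))) (c * (4 * (N + 1)) + p + 1) k = v + 1 := by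
  have hj := j.2
  rcases c with _ | c
  · have hR : Rel l (0 * (4 * (N + 1)) + 4 * j) (j, 0) :=
      ⟨0, 4 * j, hc, by omega, rfl, Or.inl ⟨by simp, rfl, rfl⟩⟩
    have := hR.lt
    refine ⟨_, hR, ?_⟩
    rw [destination_reflect_left (t := 4 * j) ?_ (by omega)]
    · omega
    · push_cast
      linarith
  · have hR : Rel l (c * (4 * (N + 1)) + (4 * (N - j) + 2)) (j, c + 1) :=
      ⟨c, 4 * (N - j) + 2, by omega, by omega, rfl,
        Or.inr (Or.inr ⟨Or.inr (by simp only; omega), rfl⟩)⟩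
    have := hR.lt
    refine ⟨_, hR, destination_of_mem_Icc ?_ (by omega)⟩
    rw [Nat.succ_mul]
    push_cast [show (j : ℕ) ≤ N by omega]
    linarith

lemma exists_edge_of_tapeGraph {w : List α} {v : Fin (graph T w).length}
    {x y : Fin (N + 1) × ℕ} (hR : Rel w.length v x) {b : Br} (hE : tapeGraph T w x b y) :
    ∃ v', (graph T w).Edge v b v' ∧ Rel w.length v' y := by
  obtain ⟨c, p, hc, hp, hv, hS⟩ := hR
  obtain ⟨a, d, hT, ha, hd, hlt⟩ := hE
  obtain ⟨i, q⟩ := x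
  obtain ⟨j, q'⟩ := y
  have hj := j.2
  dsimp only [Stands] at hT ha hd hS hlt
  rw [TwoNPDA.length_tape] at hlt
  suffices h : ∃ k, LocalEdge T w[c] p b k ∧ ∃ v', Rel w.length v' (j, q') ∧
      destination (w.length * (4 * (N + 1))) (c * (4 * (N + 1)) + p + 1) k = v' + 1 by
    obtain ⟨k, hk, v', hR', hdest⟩ := h
    exact ⟨⟨v', by rw [length_graph]; exact hR'.lt⟩, (edge_iff hc hp hv).2 ⟨k, hk, hdest⟩, hR'⟩
  rcases hS with ⟨hpi, rfl, rfl⟩ | ⟨hpi, hcl, rfl⟩ | ⟨hpi, rfl⟩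
  · obtain rfl : a = .leftEnd := by simpa [TwoNPDA.getElem?_tape_zero] using ha.symm
    cases d
    · obtain rfl : q' = 0 := by simpa using hd
      exact ⟨4 * j - p, ⟨i, j, Or.inl ⟨hpi, Or.inl ⟨hT, by ring⟩⟩⟩,
        destination_stay (p' := 4 * j) hc (by omega) (by push_cast; ring)
          (Or.inl ⟨by simp, rfl, rfl⟩)⟩
    · simp at hd
    · obtain rfl : q' = 1 := by simp at hd; omega
      exact ⟨4 * j + 1 - p, ⟨i, j, Or.inl ⟨hpi, Or.inr ⟨hT, by ring⟩⟩⟩,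
        destination_stay (p' := 4 * j + 1) hc (by omega) (by push_cast; ring)
          (Or.inr (Or.inr ⟨Or.inl (by simp), rfl⟩))⟩
  · obtain rfl : a = .rightEnd := by simpa [TwoNPDA.getElem?_tape_last] using ha.symm
    cases d
    · obtain rfl : q' = w.length + 1 := by simp at hd; omega
      exact ⟨4 * (N - j) + 3 - p, ⟨i, j, Or.inr (Or.inl ⟨hpi, Or.inl ⟨hT, by ring⟩⟩)⟩,
        destination_stay (p' := 4 * (N - j) + 3) hc (by omega) (by omega)
          (Or.inr (Or.inl ⟨by simp only; omega, hcl, rfl⟩))⟩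
    · obtain rfl : q' = c + 1 := by simp at hd; omega
      exact ⟨4 * j + 1 - p, ⟨i, j, Or.inr (Or.inl ⟨hpi, Or.inr ⟨hT, by ring⟩⟩)⟩,
        destination_stay (p' := 4 * j + 1) hc (by omega) (by push_cast; ring)
          (Or.inr (Or.inr ⟨Or.inl (by simp), rfl⟩))⟩
    · simp at hd; omega
  · obtain rfl : a = .letter w[c] := by simpa [TwoNPDA.getElem?_tape_succ w hc] using ha.symm
    cases d
    · obtain rfl : q' = c + 1 := by simp at hd; omega
      exact ⟨4 * j + 1 - p, ⟨i, j, Or.inr (Or.inr ⟨hpi, Or.inl ⟨hT, by ring⟩⟩)⟩,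
        destination_stay (p' := 4 * j + 1) hc (by omega) (by push_cast; ring)
          (Or.inr (Or.inr ⟨Or.inl (by simp), rfl⟩))⟩
    · obtain rfl : q' = c := by simp at hd; omega
      exact ⟨4 * (N - j) + 2 - 4 * (N + 1) - p,
        ⟨i, j, Or.inr (Or.inr ⟨hpi, Or.inr (Or.inr ⟨hT, by ring⟩)⟩)⟩,
        destination_left hc (by ring)⟩
    · obtain rfl : q' = c + 2 := by simp at hd; omega
      exact ⟨4 * (N + 1) + (4 * j + 1) - p,
        ⟨i, j, Or.inr (Or.inr ⟨hpi, Or.inr (Or.inl ⟨hT, by ring⟩)⟩)⟩,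
        destination_right hc hp (by ring)⟩

lemma exists_tapeGraph_of_edge {w : List α} {v v' : Fin (graph T w).length}
    {x : Fin (N + 1) × ℕ} (hR : Rel w.length v x) {b : Br} (hE : (graph T w).Edge v b v') :
    ∃ y, tapeGraph T w x b y ∧ Rel w.length v' y := by
  obtain ⟨c, p, hc, hp, hv, hS⟩ := hR
  obtain ⟨k, ⟨i, j, hL⟩, hdest⟩ := (edge_iff hc hp hv).1 hE
  obtain ⟨i', q⟩ := x
  have hi := i.2
  have hi' := i'.2
  have hj := j.2
  suffices h : ∃ (q' : ℕ) (a : TapeCell α) (d : SignType), T i' a b j d ∧ (TwoNPDA.tape w)[q]? = some a ∧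
      (q' : ℤ) = q + (d : ℤ) ∧ q' < w.length + 2 ∧ ∃ u, Rel w.length u (j, q') ∧
        destination (w.length * (4 * (N + 1))) (c * (4 * (N + 1)) + p + 1) k = u + 1 by
    obtain ⟨q', a, d, hT, ha, hd, hlt, u, hu, hdest'⟩ := h
    -- An offset has only one destination, so the vertex found to stand for the new configuration is
    -- the given endpoint of the edge.
    obtain rfl : u = v' := by omega
    exact ⟨(j, q'), ⟨a, d, hT, ha, hd, by rwa [TwoNPDA.length_tape]⟩, hu⟩
  dsimp only [Stands] at hS
  -- The residue of `p` modulo 4 tells the kinds of vertices apart; this excludes the mismatched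
  -- cases and identifies the state.
  rcases hL with ⟨hp1, h⟩ | ⟨hp1, h⟩ | ⟨hp1, h⟩
  · obtain ⟨hpi, rfl, rfl⟩ | ⟨hpi, hcl, rfl⟩ | ⟨hpi, rfl⟩ := hS
    · obtain rfl : i = i' := Fin.ext (by omega)
      rcases h with ⟨hT, hk⟩ | ⟨hT, hk⟩
      · exact ⟨0, _, _, hT, rfl, by simp, by omega,
          destination_stay (p' := 4 * j) hc (by omega) (by omega) (Or.inl ⟨by simp, rfl, rfl⟩)⟩
      · exact ⟨1, _, _, hT, rfl, by simp, by omega,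
          destination_stay (p' := 4 * j + 1) hc (by omega) (by omega)
            (Or.inr (Or.inr ⟨Or.inl (by simp), rfl⟩))⟩
    · omega
    · omega
  · obtain ⟨hpi, rfl, rfl⟩ | ⟨hpi, hcl, rfl⟩ | ⟨hpi, rfl⟩ := hS
    · omega
    · obtain rfl : i = i' := Fin.ext (by omega)
      rcases h with ⟨hT, hk⟩ | ⟨hT, hk⟩
      · exact ⟨w.length + 1, _, _, hT, TwoNPDA.getElem?_tape_last w, by simp, by omega,
          destination_stay (p' := 4 * (N - j) + 3) hc (by omega) (by omega)
            (Or.inr (Or.inl ⟨by simp only; omega, hcl, rfl⟩))⟩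
      · exact ⟨c + 1, _, _, hT, TwoNPDA.getElem?_tape_last w, by simp; omega, by omega,
          destination_stay (p' := 4 * j + 1) hc (by omega) (by omega)
            (Or.inr (Or.inr ⟨Or.inl (by simp), rfl⟩))⟩
    · omega
  · obtain ⟨hpi, rfl, rfl⟩ | ⟨hpi, hcl, rfl⟩ | ⟨hpi, rfl⟩ := hS
    · omega
    · omega
    · obtain rfl : i = i' := Fin.ext (by omega)
      have ha := TwoNPDA.getElem?_tape_succ w hc
      rcases h with ⟨hT, hk⟩ | ⟨hT, hk⟩ | ⟨hT, hk⟩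
      · exact ⟨c + 1, _, _, hT, ha, by simp, by omega,
          destination_stay (p' := 4 * j + 1) hc (by omega) (by omega)
            (Or.inr (Or.inr ⟨Or.inl (by simp), rfl⟩))⟩
      · exact ⟨c + 2, _, _, hT, ha, by simp; omega, by omega, destination_right hc hp hk⟩
      · exact ⟨c, _, _, hT, ha, by simp, by omega, destination_left hc hk⟩

/-- On nonempty words, a bracket program accepts if and only if its graph is a yes-instance. -/
theorem yesInstance_graph_iff {w : List α} (hw : w ≠ []) :
    (graph T w).YesInstance ↔ Relation.ReflTransGen (StackStep (tapeGraph T w))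
      ((0, 0), []) ((0, w.length + 1), []) := by
  have hl : 0 < w.length := List.length_pos_iff.2 hw
  have hG := length_graph (T := T) w
  have hlast : w.length * (4 * (N + 1)) = (w.length - 1) * (4 * (N + 1)) + (4 * N + 3) + 1 := by
    obtain ⟨l, hl'⟩ := Nat.exists_eq_succ_of_ne_zero hl.ne'
    rw [hl']
    simp only [Nat.succ_eq_add_one, Nat.add_sub_cancel]
    ring
  have hn : 0 < (graph T w).length := by omega
  have hfirst : Rel (N := N) w.length 0 (0, 0) :=
    ⟨0, 0, hl, by omega, by simp, Or.inl ⟨by simp, rfl, rfl⟩⟩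
  -- A configuration on a letter may be represented by two vertices, but the accepting one, state
  -- `0` on the right endmarker, belongs to the last vertex only, at local position `4 * N + 3`. So
  -- a walk reaching it ends where required.
  have hsecond : ∀ y : Fin (N + 1) × ℕ,
      Rel w.length ((graph T w).length - 1) y ↔ y = (0, w.length + 1) := by
    rintro ⟨i, q⟩
    have hi := i.2
    constructor
    · rintro ⟨c, p, hc, hp, hv, hS⟩
      have h : c * (4 * (N + 1)) + p = (w.length - 1) * (4 * (N + 1)) + (4 * N + 3) := by omega
      obtain rfl : p = 4 * N + 3 := by
        have := congrArg (· % (4 * (N + 1))) h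
        simp only [Nat.mul_add_mod_self_right, Nat.mod_eq_of_lt hp] at this
        rw [this, Nat.mod_eq_of_lt (by omega)]
      dsimp only [Stands] at hS
      obtain ⟨hpi, hc0, rfl⟩ | ⟨hpi, hcl, rfl⟩ | ⟨hpi, rfl⟩ := hS
      · omega
      · obtain rfl : i = 0 := Fin.ext (by rw [Fin.val_zero]; omega)
        rfl
      · omega
    · intro h
      rw [h]
      exact ⟨w.length - 1, 4 * N + 3, by omega, by omega, by omega,
        Or.inr (Or.inl ⟨by simp, by omega, rfl⟩)⟩
  simp only [RelGraph.YesInstance, hn, exists_true_left, dyckTwoReach_iff]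
  constructor
  · intro h
    obtain ⟨y, hy, hr⟩ := reflTransGen_stackStep_of_simulation (E' := tapeGraph T w)
      (R := fun (v : Fin (graph T w).length) x => Rel w.length v x)
      (fun v x hR b v' hE => exists_tapeGraph_of_edge hR hE) h hfirst
    rwa [(hsecond y).1 hy] at hr
  · intro h
    obtain ⟨v, hv, hr⟩ := reflTransGen_stackStep_of_simulation (E' := (graph T w).Edge)
      (R := fun x (v : Fin (graph T w).length) => Rel w.length v x)
      (fun x v hR b y hE => exists_edge_of_tapeGraph hR hE) h (x' := ⟨0, hn⟩) hfirst
    have hv' : v = ⟨(graph T w).length - 1, Nat.sub_lt hn Nat.one_pos⟩ := by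
      obtain ⟨c, p, hc, hp, hvp, hS⟩ := hv
      dsimp only [Stands] at hS
      obtain ⟨hpi, hc0, h0⟩ | ⟨hpi, hcl, -⟩ | ⟨hpi, h0⟩ := hS
      · omega
      · refine Fin.ext ?_
        obtain rfl : c = w.length - 1 := by omega
        simp at hpi
        simp only
        omega
      · omega
    rwa [hv'] at hr

/-- The homomorphism that maps a letter to the code of its block. -/
noncomputable def encodeHom
    (T : Fin (N + 1) → TapeCell α → Br → Fin (N + 1) → SignType → Prop) :
    FreeMonoid α →* FreeMonoid HardSym :=
  FreeMonoid.lift fun a => FreeMonoid.ofList (block T a).encode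

lemma toList_encodeHom (w : List α) :
    FreeMonoid.toList (encodeHom T (FreeMonoid.ofList w)) = (graph T w).encode := by
  induction w with
  | nil => rfl
  | cons a w ih =>
    rw [FreeMonoid.ofList_cons, map_mul, FreeMonoid.toList_mul, ih]
    simp [encodeHom, graph, RelGraph.encode]

end BracketProgram

/-! ### The codes of graphs -/

/-- A word that is empty or starts with a separator. -/
def SepOrNil (l : List HardSym) : Prop := l = [] ∨ ∃ l', l = HardSym.sep :: l'

/-- The code of a list of further edges. -/
def encodeTail (B : List (Br × ℤ)) : List HardSym :=
  B.flatMap fun e => HardSym.sep :: encodeEdge e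

lemma encodeTail_cons (e : Br × ℤ) (B : List (Br × ℤ)) :
    encodeTail (e :: B) =
      .sep :: .bracket e.1 :: (encodeOffset e.2 ++ encodeTail B) := by
  simp [encodeTail, encodeEdge]

lemma sepOrNil_encodeTail (B : List (Br × ℤ)) : SepOrNil (encodeTail B) := by
  cases B with
  | nil => exact Or.inl rfl
  | cons e B => exact Or.inr ⟨_, encodeTail_cons e B⟩

lemma encodeVertex_nil : encodeVertex [] = [.vmark] := rfl

lemma encodeVertex_cons (e : Br × ℤ) (B : List (Br × ℤ)) :
    encodeVertex (e :: B) = .vmark :: .bracket e.1 :: (encodeOffset e.2 ++ encodeTail B) := by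
  have h : ∀ (e : Br × ℤ) (B : List (Br × ℤ)),
      List.intercalate [HardSym.sep] ((e :: B).map encodeEdge) = encodeEdge e ++ encodeTail B := by
    intro e B
    induction B generalizing e with
    | nil => simp [List.intercalate, encodeTail]
    | cons e' B ih =>
      have := ih e'
      simp only [List.intercalate, List.map_cons, List.intersperse_cons_cons, List.flatten_cons] at this ⊢
      rw [this, encodeTail_cons]
      simp [encodeEdge]
  rw [encodeVertex, h]
  simp [encodeEdge]

lemma encodeVertex_append_singleton (B : List (Br × ℤ)) (b : Br) (k : ℤ) :
    encodeVertex (B ++ [(b, k)]) =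
      encodeVertex B ++ (if B = [] then [] else [.sep]) ++ .bracket b :: encodeOffset k := by
  cases B with
  | nil => simp [encodeVertex_cons, encodeVertex_nil, encodeTail]
  | cons e B => simp [encodeVertex_cons, encodeTail, encodeEdge]

lemma RelGraph.encode_append (G G' : RelGraph) :
    RelGraph.encode (G ++ G') = G.encode ++ G'.encode := by
  simp [RelGraph.encode]

lemma RelGraph.encode_singleton (B : List (Br × ℤ)) : RelGraph.encode [B] = encodeVertex B := by
  simp [RelGraph.encode]

/-! ### A finite automaton for well-formed codes. -/

/-- The states of the automaton that recognizes the codes of nonempty graphs. -/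
inductive CheckState : Type
  | first
  | vertex
  | bracket
  | minus
  | ones
  | sep

namespace CheckState

/-- The transition function of the automaton that recognizes the codes of nonempty graphs. -/
def next : CheckState → HardSym → Option CheckState
  | first, .vmark => some vertex
  | vertex, .vmark => some vertex
  | vertex, .bracket _ => some bracket
  | bracket, .vmark => some vertex
  | bracket, .sep => some sep
  | bracket, .minus => some minus
  | bracket, .one => some ones
  | minus, .one => some ones
  | ones, .vmark => some vertex
  | ones, .sep => some sep
  | ones, .one => some ones
  | sep, .bracket _ => some bracket
  | _, _ => none

/-- The states in which the word read so far is the code of a nonempty graph. -/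
def Accepting : CheckState → Prop
  | vertex => True
  | bracket => True
  | ones => True
  | _ => False

/-- What the word read so far is like. -/
def Form (u : List HardSym) : CheckState → Prop
  | first => u = []
  | vertex => ∃ G : RelGraph, u = RelGraph.encode (G ++ [[]])
  | bracket => ∃ (G : RelGraph) (B : List (Br × ℤ)) (b : Br),
      u = RelGraph.encode (G ++ [B ++ [(b, 0)]])
  | minus => ∃ (G : RelGraph) (B : List (Br × ℤ)) (b : Br),
      u = RelGraph.encode (G ++ [B ++ [(b, 0)]]) ++ [.minus]
  | ones => ∃ (G : RelGraph) (B : List (Br × ℤ)) (b : Br) (k : ℤ), k ≠ 0 ∧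
      u = RelGraph.encode (G ++ [B ++ [(b, k)]])
  | sep => ∃ (G : RelGraph) (B : List (Br × ℤ)), B ≠ [] ∧
      u = RelGraph.encode (G ++ [B]) ++ [.sep]

lemma form_vertex (G : RelGraph) : Form (G.encode ++ [.vmark]) vertex :=
  ⟨G, by rw [RelGraph.encode_append, RelGraph.encode_singleton, encodeVertex_nil]⟩

lemma form_sep (G : RelGraph) (B : List (Br × ℤ)) (e : Br × ℤ) :
    Form (RelGraph.encode (G ++ [B ++ [e]]) ++ [.sep]) sep :=
  ⟨G, B ++ [e], by simp, rfl⟩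

/-- Covers the three ways to read a digit: after a label, after a minus sign, and after another
digit. The offset is nonzero in each case, so a minus sign is never left without digits. -/
lemma form_ones (G : RelGraph) (B : List (Br × ℤ)) (b : Br) {k : ℤ} {l : List HardSym} {k' : ℤ}
    (hk : k' ≠ 0) (h : encodeOffset k ++ l = encodeOffset k') :
    Form (RelGraph.encode (G ++ [B ++ [(b, k)]]) ++ l) ones := by
  refine ⟨G, B, b, k', hk, ?_⟩
  rw [RelGraph.encode_append, RelGraph.encode_append, RelGraph.encode_singleton,
    RelGraph.encode_singleton, encodeVertex_append_singleton,
    encodeVertex_append_singleton, ← h]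
  simp

lemma encodeOffset_append_one {k : ℤ} (_hk : k ≠ 0) :
    ∃ k', k' ≠ 0 ∧ encodeOffset k ++ [.one] = encodeOffset k' := by
  by_cases h : k < 0
  · refine ⟨k - 1, by omega, ?_⟩
    rw [encodeOffset, encodeOffset, if_pos h, if_pos (by omega),
      show (k - 1).natAbs = k.natAbs + 1 by omega, List.replicate_succ', List.append_assoc]
  · refine ⟨k + 1, by omega, ?_⟩
    rw [encodeOffset, encodeOffset, if_neg h, if_neg (by omega),
      show (k + 1).natAbs = k.natAbs + 1 by omega, List.replicate_succ', List.append_assoc]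

lemma form_next {u : List HardSym} {f f' : CheckState} {a : HardSym} (h : Form u f)
    (hf : f.next a = some f') : Form (u ++ [a]) f' := by
  cases f <;> cases a <;> simp only [next, Option.some.injEq, reduceCtorEq] at hf <;> subst hf
  · obtain rfl := h
    exact form_vertex []
  · obtain ⟨G, rfl⟩ := h
    refine ⟨G, [], ‹Br›, ?_⟩
    rw [RelGraph.encode_append, RelGraph.encode_append, RelGraph.encode_singleton,
      RelGraph.encode_singleton, encodeVertex_append_singleton]
    simp [encodeOffset]
  · obtain ⟨G, rfl⟩ := h
    exact form_vertex _
  · obtain ⟨G, B, b, rfl⟩ := h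
    exact form_vertex _
  · obtain ⟨G, B, b, rfl⟩ := h
    exact form_ones G B b one_ne_zero rfl
  · obtain ⟨G, B, b, rfl⟩ := h
    exact ⟨G, B, b, rfl⟩
  · obtain ⟨G, B, b, rfl⟩ := h
    exact form_sep G B _
  · obtain ⟨G, B, b, rfl⟩ := h
    rw [List.append_assoc]
    exact form_ones G B b (show (-1 : ℤ) ≠ 0 by decide) rfl
  · obtain ⟨G, B, b, k, hk, rfl⟩ := h
    exact form_vertex _
  · obtain ⟨G, B, b, k, hk, rfl⟩ := h
    obtain ⟨k', hk', he⟩ := encodeOffset_append_one hk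
    exact form_ones G B b hk' he
  · obtain ⟨G, B, b, k, hk, rfl⟩ := h
    exact form_sep G B _
  · obtain ⟨G, B, hB, rfl⟩ := h
    refine ⟨G, B, ‹Br›, ?_⟩
    rw [RelGraph.encode_append, RelGraph.encode_append, RelGraph.encode_singleton,
      RelGraph.encode_singleton, encodeVertex_append_singleton]
    simp [encodeOffset, hB]

/-- The state reached from `f` by reading a word, if any. -/
def run (f : CheckState) (u : List HardSym) : Option CheckState := u.foldlM next f

lemma run_nil (f : CheckState) : f.run [] = some f := rfl

lemma run_cons (f : CheckState) (a : HardSym) (u : List HardSym) :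
    f.run (a :: u) = (f.next a).bind fun f' => f'.run u := rfl

lemma run_append (f : CheckState) (u v : List HardSym) :
    f.run (u ++ v) = (f.run u).bind fun f' => f'.run v := by
  simp [run, List.foldlM_append]

lemma form_run {u : List HardSym} {f : CheckState} (h : first.run u = some f) : Form u f := by
  induction u using List.reverseRecOn generalizing f with
  | nil =>
    obtain rfl : first = f := by simpa [run_nil] using h
    rfl
  | append_singleton u a ih =>
    rw [run_append, Option.bind_eq_some_iff] at h
    obtain ⟨f₁, h1, h2⟩ := h
    rw [run_cons, Option.bind_eq_some_iff] at h2
    obtain ⟨f₂, h2, h3⟩ := h2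
    obtain rfl : f₂ = f := by simpa [run_nil] using h3
    exact form_next (ih h1) h2

/-- The states record which unfinished piece ends the word; in an accepting state nothing is
unfinished. -/
lemma exists_encode_of_run {u : List HardSym} {f : CheckState} (h : first.run u = some f)
    (hf : f.Accepting) : ∃ G : RelGraph, u = G.encode ∧ G ≠ [] := by
  have := form_run h
  cases f
  · exact hf.elim
  · obtain ⟨G, rfl⟩ := this
    exact ⟨_, rfl, by simp⟩
  · obtain ⟨G, B, b, rfl⟩ := this
    exact ⟨_, rfl, by simp⟩
  · exact hf.elim
  · obtain ⟨G, B, b, k, -, rfl⟩ := this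
    exact ⟨_, rfl, by simp⟩
  · exact hf.elim

lemma run_ones (n : ℕ) : ones.run (List.replicate n .one) = some ones := by
  induction n with
  | zero => rfl
  | succ n ih => rw [List.replicate_succ, run_cons]; exact ih

lemma run_encodeOffset (k : ℤ) :
    bracket.run (encodeOffset k) = some bracket ∨ bracket.run (encodeOffset k) = some ones := by
  unfold encodeOffset
  by_cases h0 : k = 0
  · subst h0; exact Or.inl rfl
  · obtain ⟨n, hn⟩ := Nat.exists_eq_succ_of_ne_zero (Int.natAbs_ne_zero.2 h0)
    rw [hn, List.replicate_succ]
    right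
    by_cases h : k < 0
    · rw [if_pos h]
      exact run_ones n
    · rw [if_neg h]
      exact run_ones n

lemma run_encodeTail (B : List (Br × ℤ)) {f : CheckState} (hf : f = bracket ∨ f = ones) :
    f.run (encodeTail B) = some bracket ∨ f.run (encodeTail B) = some ones := by
  induction B generalizing f with
  | nil => rcases hf with rfl | rfl <;> simp [encodeTail, run_nil]
  | cons e B ih =>
    rw [encodeTail_cons]
    have h : f.run (.sep :: .bracket e.1 :: (encodeOffset e.2 ++ encodeTail B)) =
        bracket.run (encodeOffset e.2 ++ encodeTail B) := by
      rcases hf with rfl | rfl <;> rfl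
    rw [h, run_append]
    rcases run_encodeOffset e.2 with h | h
    · rw [h]; exact ih (Or.inl rfl)
    · rw [h]; exact ih (Or.inr rfl)

lemma exists_run_encodeVertex (B : List (Br × ℤ)) {f : CheckState}
    (hf : f = first ∨ f.Accepting) :
    ∃ f', f.run (encodeVertex B) = some f' ∧ f'.Accepting := by
  have hv : f.next .vmark = some vertex := by
    rcases hf with rfl | hf
    · rfl
    · cases f <;> first | rfl | exact hf.elim
  cases B with
  | nil => exact ⟨vertex, by rw [encodeVertex_nil, run_cons, hv]; rfl, trivial⟩
  | cons e B =>
    rw [encodeVertex_cons, run_cons, hv, Option.bind_some, run_cons]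
    simp only [next, Option.bind_some]
    rw [run_append]
    have h : bracket.run (encodeOffset e.2) = some bracket ∨
        bracket.run (encodeOffset e.2) = some ones := run_encodeOffset e.2
    rcases h with h | h <;> rw [h, Option.bind_some]
    · rcases run_encodeTail B (Or.inl rfl) with h | h <;> exact ⟨_, h, trivial⟩
    · rcases run_encodeTail B (Or.inr rfl) with h | h <;> exact ⟨_, h, trivial⟩

lemma exists_run_encode {G : RelGraph} (hG : G ≠ []) :
    ∃ f, first.run G.encode = some f ∧ f.Accepting := by
  have h : ∀ (G : RelGraph) (f : CheckState), f.Accepting →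
      ∃ f', f.run G.encode = some f' ∧ f'.Accepting := by
    intro G
    induction G with
    | nil => exact fun f hf => ⟨f, rfl, hf⟩
    | cons B G ih =>
      intro f hf
      obtain ⟨f₁, h1, hf₁⟩ := exists_run_encodeVertex B (Or.inr hf)
      obtain ⟨f₂, h2, hf₂⟩ := ih f₁ hf₁
      exact ⟨f₂, by rw [RelGraph.encode, List.flatMap_cons, run_append, h1]; exact h2, hf₂⟩
  obtain ⟨B, G, rfl⟩ := List.exists_cons_of_ne_nil hG
  obtain ⟨f₁, h1, hf₁⟩ := exists_run_encodeVertex B (Or.inl rfl)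
  obtain ⟨f₂, h2, hf₂⟩ := h G f₁ hf₁
  exact ⟨f₂, by rw [RelGraph.encode, List.flatMap_cons, run_append, h1]; exact h2, hf₂⟩

end CheckState

/-! ### Edges on the tape -/

lemma bracket_not_mem_encodeOffset (b : Br) (k : ℤ) : HardSym.bracket b ∉ encodeOffset k := by
  unfold encodeOffset
  split_ifs <;> simp [List.mem_replicate]

lemma vmark_not_mem_encodeOffset (k : ℤ) : HardSym.vmark ∉ encodeOffset k := by
  unfold encodeOffset
  split_ifs <;> simp [List.mem_replicate]

lemma length_encodeOffset (k : ℤ) :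
    (encodeOffset k).length = (if k < 0 then 1 else 0) + k.natAbs := by
  unfold encodeOffset
  split_ifs <;> simp [Nat.add_comm]

/-- Offsets contain no brackets, so a bracket found after an offset must lie among the further
edges. -/
lemma exists_edge_of_encodeOffset_append {B : List (Br × ℤ)}
    (hB : ∀ l b r, encodeTail B = l ++ .bracket b :: r → ∃ k l₂, (b, k) ∈ B ∧
      r = encodeOffset k ++ l₂ ∧ SepOrNil l₂)
    {b : Br} {k₀ : ℤ} {l r : List HardSym}
    (h : encodeOffset k₀ ++ encodeTail B = l ++ .bracket b :: r) :
    ∃ k l₂, (b, k) ∈ B ∧ r = encodeOffset k ++ l₂ ∧ SepOrNil l₂ := by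
  rcases List.append_eq_append_iff.1 h with ⟨l', rfl, h'⟩ | ⟨c, hc, h'⟩
  · exact hB _ _ _ h'
  · cases c with
    | nil => exact hB [] _ _ h'.symm
    | cons a c =>
      simp only [List.cons_append, List.cons.injEq] at h'
      refine absurd ?_ (bracket_not_mem_encodeOffset b k₀)
      rw [hc, ← h'.1]
      simp

lemma exists_edge_of_encodeTail_eq (B : List (Br × ℤ)) : ∀ l b r,
    encodeTail B = l ++ .bracket b :: r → ∃ k l₂, (b, k) ∈ B ∧
      r = encodeOffset k ++ l₂ ∧ SepOrNil l₂ := by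
  induction B with
  | nil => intro l b r h; simp [encodeTail] at h
  | cons e B ih =>
    intro l b r h
    rw [encodeTail_cons] at h
    match l, h with
    | [], h => simp at h
    | [_], h =>
      simp only [List.cons_append, List.nil_append, List.cons.injEq, HardSym.bracket.injEq] at h
      obtain ⟨-, rfl, rfl⟩ := h
      exact ⟨e.2, _, by simp, rfl, sepOrNil_encodeTail B⟩
    | _ :: _ :: l, h =>
      simp only [List.cons_append, List.cons.injEq] at h
      obtain ⟨k, l₂, hk, hr, hl⟩ := exists_edge_of_encodeOffset_append ih h.2.2
      exact ⟨k, l₂, List.mem_cons_of_mem _ hk, hr, hl⟩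

/-- Every bracket on the tape is the label of a genuine edge, so the automaton may choose any
bracket of a block. The offset it reads next is delimited by a separator or by the end of the block.
-/
lemma exists_edge_of_encodeVertex_eq {B : List (Br × ℤ)} {l r : List HardSym} {b : Br}
    (h : encodeVertex B = l ++ .bracket b :: r) :
    ∃ k l₂, (b, k) ∈ B ∧ r = encodeOffset k ++ l₂ ∧ SepOrNil l₂ := by
  cases B with
  | nil =>
    rw [encodeVertex_nil] at h
    cases l <;> simp at h
  | cons e B =>
    rw [encodeVertex_cons] at h
    match l, h with
    | [], h => simp at h
    | [_], h =>
      simp only [List.cons_append, List.nil_append, List.cons.injEq, HardSym.bracket.injEq] at h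
      obtain ⟨-, rfl, rfl⟩ := h
      exact ⟨e.2, _, by simp, rfl, sepOrNil_encodeTail B⟩
    | _ :: _ :: l, h =>
      simp only [List.cons_append, List.cons.injEq] at h
      obtain ⟨k, l₂, hk, hr, hl⟩ :=
        exists_edge_of_encodeOffset_append (exists_edge_of_encodeTail_eq B) h.2.2
      exact ⟨k, l₂, List.mem_cons_of_mem _ hk, hr, hl⟩

lemma exists_encodeVertex_eq {B : List (Br × ℤ)} {b : Br} {k : ℤ} (h : (b, k) ∈ B) :
    ∃ l l₂, encodeVertex B = l ++ .bracket b :: (encodeOffset k ++ l₂) ∧ SepOrNil l₂ := by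
  obtain ⟨B₁, B₂, rfl⟩ := List.append_of_mem h
  cases B₁ with
  | nil => exact ⟨[.vmark], _, encodeVertex_cons _ _, sepOrNil_encodeTail B₂⟩
  | cons e B₁ =>
    refine ⟨.vmark :: .bracket e.1 :: (encodeOffset e.2 ++ encodeTail B₁ ++ [.sep]), _, ?_,
      sepOrNil_encodeTail B₂⟩
    rw [List.cons_append, encodeVertex_cons]
    simp [encodeTail, encodeEdge]

lemma encodeVertex_eq_cons (B : List (Br × ℤ)) :
    ∃ u, encodeVertex B = .vmark :: u ∧ HardSym.vmark ∉ u := by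
  cases B with
  | nil => exact ⟨[], rfl, by simp⟩
  | cons e B =>
    refine ⟨_, encodeVertex_cons e B, ?_⟩
    simp only [List.mem_cons, reduceCtorEq, List.mem_append, vmark_not_mem_encodeOffset, false_or,
      encodeTail, encodeEdge, List.mem_flatMap, not_exists, not_and]
    simp

/-! ### Tape positions of vertex markers and edges. -/

namespace RelGraph

/-- The tape position of the marker of the `p`-th vertex; the endmarkers count as the vertices
`0` and `G.length + 1`. -/
def markerPos (G : RelGraph) : ℕ → ℕ
  | 0 => 0
  | p + 1 => (RelGraph.encode (G.take p)).length + 1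

/-- The contents of the cells that represent positions of vertices. -/
inductive IsMarker : TapeCell HardSym → Prop
  | leftEnd : IsMarker .leftEnd
  | vmark : IsMarker (.letter .vmark)
  | rightEnd : IsMarker .rightEnd

/-- The tape with the code of the graph. -/
abbrev codeTape (G : RelGraph) : List (TapeCell HardSym) := TwoNPDA.tape G.encode

variable {G : RelGraph}

lemma markerPos_length (G : RelGraph) : G.markerPos (G.length + 1) = G.encode.length + 1 := by
  simp [markerPos]

lemma length_codeTape (G : RelGraph) : G.codeTape.length = G.encode.length + 2 :=
  TwoNPDA.length_tape _

lemma encode_eq_append {i : ℕ} (hi : i < G.length) :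
    G.encode = RelGraph.encode (G.take i) ++
      (encodeVertex G[i] ++ RelGraph.encode (G.drop (i + 1))) := by
  have h := congrArg RelGraph.encode (List.take_append_drop i G)
  rw [List.drop_eq_getElem_cons hi, encode_append] at h
  exact h.symm

lemma markerPos_succ_succ {i : ℕ} (hi : i < G.length) :
    G.markerPos (i + 2) = G.markerPos (i + 1) + (encodeVertex G[i]).length := by
  rw [markerPos, markerPos, List.take_succ_eq_append_getElem hi, encode_append, encode_singleton,
    List.length_append]
  omega

lemma markerPos_lt_succ {p : ℕ} (hp : p ≤ G.length) : G.markerPos p < G.markerPos (p + 1) := by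
  cases p with
  | zero => simp [markerPos]
  | succ i =>
    obtain ⟨u, hu, -⟩ := encodeVertex_eq_cons (G[i]'hp)
    rw [markerPos_succ_succ hp, hu, List.length_cons]
    omega

lemma markerPos_le_of_le {p q : ℕ} (hpq : p ≤ q) (hq : q ≤ G.length + 1) :
    G.markerPos p ≤ G.markerPos q := by
  induction q, hpq using Nat.le_induction with
  | base => exact le_rfl
  | succ q _ ih => exact (ih (by omega)).trans (markerPos_lt_succ (by omega)).le

lemma markerPos_lt_length {p : ℕ} (hp : p ≤ G.length + 1) :
    G.markerPos p < G.codeTape.length := by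
  have := markerPos_le_of_le hp le_rfl
  rw [markerPos_length] at this
  rw [length_codeTape]
  omega

lemma getElem?_codeTape {i t : ℕ} (hi : i < G.length) {c : HardSym}
    (h : (encodeVertex G[i])[t]? = some c) :
    G.codeTape[G.markerPos (i + 1) + t]? = some (.letter c) := by
  have ht := (List.getElem?_eq_some_iff.1 h).1
  rw [codeTape, TwoNPDA.tape, markerPos, encode_eq_append hi,
    show (RelGraph.encode (G.take i)).length + 1 + t =
      (RelGraph.encode (G.take i)).length + t + 1 by omega, List.getElem?_cons_succ,
    List.map_append, List.append_assoc, List.getElem?_append_right (by simp)]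
  rw [List.length_map, Nat.add_sub_cancel_left, List.map_append, List.append_assoc,
    List.getElem?_append_left (by simpa using ht), List.getElem?_map, h]
  rfl

lemma getElem?_markerPos_zero : G.codeTape[G.markerPos 0]? = some .leftEnd := rfl

lemma getElem?_markerPos_succ {i : ℕ} (hi : i < G.length) :
    G.codeTape[G.markerPos (i + 1)]? = some (.letter .vmark) := by
  obtain ⟨u, hu, -⟩ := encodeVertex_eq_cons G[i]
  exact getElem?_codeTape (t := 0) hi (by rw [hu]; rfl)

lemma getElem?_markerPos_last : G.codeTape[G.markerPos (G.length + 1)]? = some .rightEnd := by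
  rw [markerPos_length]
  exact TwoNPDA.getElem?_tape_last _

lemma exists_marker {p : ℕ} (hp : p ≤ G.length + 1) :
    ∃ a, IsMarker a ∧ G.codeTape[G.markerPos p]? = some a := by
  rcases p with _ | p
  · exact ⟨_, .leftEnd, getElem?_markerPos_zero⟩
  · rcases Nat.lt_or_ge p G.length with h | h
    · exact ⟨_, .vmark, getElem?_markerPos_succ h⟩
    · obtain rfl : p = G.length := by omega
      exact ⟨_, .rightEnd, getElem?_markerPos_last⟩

lemma exists_letter_between {p x : ℕ} (hp : p ≤ G.length) (h1 : G.markerPos p < x)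
    (h2 : x < G.markerPos (p + 1)) : ∃ c, c ≠ .vmark ∧ G.codeTape[x]? = some (.letter c) := by
  cases p with
  | zero => simp [markerPos, RelGraph.encode] at h1 h2; omega
  | succ i =>
    rw [markerPos_succ_succ hp] at h2
    obtain ⟨u, hu, hu'⟩ := encodeVertex_eq_cons (G[i]'hp)
    rw [hu, List.length_cons] at h2
    obtain ⟨t, rfl⟩ : ∃ t, x = G.markerPos (i + 1) + (t + 1) :=
      ⟨x - G.markerPos (i + 1) - 1, by omega⟩
    have ht : t < u.length := by omega
    refine ⟨u[t], fun h => hu' (h ▸ List.getElem_mem ht), getElem?_codeTape hp ?_⟩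
    rw [hu]
    simp [ht]

/-- The position of the first digit of the offset `k` of an edge whose label is at `y`. -/
def digitsPos (y : ℕ) (k : ℤ) : ℕ := if k < 0 then y + 2 else y + 1

/-- The edge with label `b` and offset `k` of the vertex with index `i` has its code at
position `y`. -/
structure EdgeAt (G : RelGraph) (i : ℕ) (y : ℕ) (b : Br) (k : ℤ) : Prop where
  mem : ∃ h : i < G.length, (b, k) ∈ G[i]
  lower : G.markerPos (i + 1) < y
  upper : digitsPos y k + k.natAbs ≤ G.markerPos (i + 2)
  label : G.codeTape[y]? = some (.letter (.bracket b))
  sign : k < 0 → G.codeTape[y + 1]? = some (.letter .minus)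
  digit : ∀ t < k.natAbs, G.codeTape[digitsPos y k + t]? = some (.letter .one)
  terminator : ∃ a, G.codeTape[digitsPos y k + k.natAbs]? = some a ∧ a ≠ .letter .one ∧
    a ≠ .letter .minus

lemma edgeAt_of_encodeVertex_eq {i : ℕ} (hi : i < G.length) {b : Br} {k : ℤ}
    {l l₂ : List HardSym} (hk : (b, k) ∈ G[i])
    (h : encodeVertex G[i] = l ++ .bracket b :: (encodeOffset k ++ l₂)) (hl : SepOrNil l₂) :
    G.EdgeAt i (G.markerPos (i + 1) + l.length) b k := by
  have hl0 : 0 < l.length := by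
    cases l with
    | nil =>
      obtain ⟨u, hu, -⟩ := encodeVertex_eq_cons G[i]
      rw [hu] at h
      simp at h
    | cons _ _ => simp
  have hlen := congrArg List.length h
  have hm := markerPos_succ_succ hi
  have hget : ∀ t c, (encodeOffset k ++ l₂)[t]? = some c →
      G.codeTape[G.markerPos (i + 1) + l.length + 1 + t]? = some (.letter c) := by
    intro t c hc
    rw [Nat.add_assoc, Nat.add_assoc]
    apply getElem?_codeTape hi
    rw [h, List.getElem?_append_right (by omega),
      show l.length + (1 + t) - l.length = t + 1 by omega, List.getElem?_cons_succ, hc]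
  have hD : digitsPos (G.markerPos (i + 1) + l.length) k + k.natAbs =
      G.markerPos (i + 1) + l.length + 1 + (encodeOffset k).length := by
    rw [length_encodeOffset, digitsPos]
    split_ifs <;> omega
  simp only [List.length_append, List.length_cons] at hlen
  refine ⟨⟨hi, hk⟩, by omega, by omega, ?_, fun hneg => ?_, fun t ht => ?_, ?_⟩
  · apply getElem?_codeTape hi
    rw [h]
    simp
  · exact hget 0 _ (by simp [encodeOffset, hneg])
  · have hp : digitsPos (G.markerPos (i + 1) + l.length) k + t =
        G.markerPos (i + 1) + l.length + 1 + ((if k < 0 then 1 else 0) + t) := by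
      rw [digitsPos]
      split_ifs <;> omega
    rw [hp]
    apply hget
    rw [List.getElem?_append_left (by rw [length_encodeOffset]; omega), encodeOffset]
    split_ifs <;> simp [Nat.add_comm 1, ht]
  · rw [hD]
    -- The offset of the last edge ends at the next marker, which for the last vertex is the right
    -- endmarker of the tape.
    rcases hl with rfl | ⟨l', rfl⟩
    · obtain ⟨a, ha, ha'⟩ := exists_marker (G := G) (p := i + 2) (by omega)
      refine ⟨a, ?_, ?_⟩
      · rw [← ha']
        congr 1
        simp only [List.length_nil] at hlen
        omega
      · cases ha <;> simp
    · exact ⟨_, hget (encodeOffset k).length .sep (by simp), by simp, by simp⟩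

lemma exists_edgeAt_of_mem {i : ℕ} (hi : i < G.length) {b : Br} {k : ℤ} (hk : (b, k) ∈ G[i]) :
    ∃ y, G.EdgeAt i y b k := by
  obtain ⟨l, l₂, h, hl⟩ := exists_encodeVertex_eq hk
  exact ⟨_, edgeAt_of_encodeVertex_eq hi hk h hl⟩

lemma exists_edgeAt_of_getElem? {i y : ℕ} (hi : i < G.length) (h1 : G.markerPos (i + 1) < y)
    (h2 : y < G.markerPos (i + 2)) {b : Br} (h : G.codeTape[y]? = some (.letter (.bracket b))) :
    ∃ k, G.EdgeAt i y b k := by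
  rw [markerPos_succ_succ hi] at h2
  obtain ⟨t, rfl⟩ : ∃ t, y = G.markerPos (i + 1) + t := ⟨y - G.markerPos (i + 1), by omega⟩
  have ht : t < (encodeVertex G[i]).length := by omega
  have hb : (encodeVertex G[i])[t] = .bracket b := by
    rw [getElem?_codeTape hi (List.getElem?_eq_getElem ht)] at h
    simpa using h
  have hsplit : encodeVertex G[i] =
      (encodeVertex G[i]).take t ++ .bracket b :: (encodeVertex G[i]).drop (t + 1) := by
    rw [← hb, ← List.drop_eq_getElem_cons ht, List.take_append_drop]
  obtain ⟨k, l₂, hk, hr, hl⟩ := exists_edge_of_encodeVertex_eq hsplit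
  rw [hr] at hsplit
  have := edgeAt_of_encodeVertex_eq hi hk hsplit hl
  rw [List.length_take, Nat.min_eq_left ht.le] at this
  exact ⟨k, this⟩

end RelGraph

/-! ### The automaton for Dyck-2 reachability -/

/-- The stack symbols: the end-of-stack symbol, a mark that counts a unit of an offset, and the
open brackets. -/
inductive WalkSym : Type
  | bottom
  | mark
  | br (k : Bool)

/-- The states. The automaton checks that the input is a code (`check`), returns to the first vertex
(`rewind`), and then walks: at a vertex (`vertex`) it looks for an edge (`scan`), reads its sign
(`sign`), pushes its offset (`count`), returns to the vertex (`back`), and moves by the offset from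
marker (`jump`) to marker (`seek`). In state `finish` it verifies that the last vertex has been
reached. The Boolean is the direction (`true` for right). -/
inductive WalkState : Type
  | start
  | check (f : CheckState)
  | rewind
  | vertex
  | scan
  | sign
  | count (d : Bool)
  | back (d : Bool)
  | jump (d : Bool)
  | seek (d : Bool)
  | finish

/-- The head move of a direction. -/
def dirSign : Bool → SignType
  | true => 1
  | false => -1

/-- The direction in which a head goes on at a marker. -/
def turn : TapeCell HardSym → Bool → Bool
  | .leftEnd, _ => true
  | .rightEnd, _ => false
  | .letter _, d => d

open RelGraph (IsMarker)

/-- The transitions of the automaton for Dyck-2 reachability. -/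
inductive WalkRule : WalkState → TapeCell HardSym → WalkSym → WalkState → List WalkSym →
    SignType → Prop
  | start (Z) : WalkRule .start .leftEnd Z (.check .first) [Z] 1
  | check {f f' a} (Z) : f.next a = some f' →
      WalkRule (.check f) (.letter a) Z (.check f') [Z] 1
  | checked {f} (Z) : f.Accepting → WalkRule (.check f) .rightEnd Z .rewind [Z] (-1)
  | rewind (a Z) : WalkRule .rewind (.letter a) Z .rewind [Z] (-1)
  | rewound (Z) : WalkRule .rewind .leftEnd Z .vertex [Z] 1
  | depart (Z) : WalkRule .vertex (.letter .vmark) Z .scan [Z] 1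
  | finish (Z) : WalkRule .vertex (.letter .vmark) Z .finish [Z] 1
  -- No vertex marker may be crossed, so the right endmarker is reached only from the last vertex.
  | finishSkip {a} (Z) : a ≠ .vmark → WalkRule .finish (.letter a) Z .finish [Z] 1
  | scan {a} (Z) : a ≠ .vmark → WalkRule .scan (.letter a) Z .scan [Z] 1
  | push (k Z) : WalkRule .scan (.letter (.bracket (Br.opening k))) Z .sign [.br k, Z] 1
  | pop (k) : WalkRule .scan (.letter (.bracket (Br.closing k))) (.br k) .sign [] 1
  | minus (Z) : WalkRule .sign (.letter .minus) Z (.count false) [Z] 1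
  -- The head stays, since there is no sign to skip: the scanned cell is already the first digit or,
  -- for offset `0`, the cell after the label.
  | plus {a} (Z) : a ≠ .letter .minus → WalkRule .sign a Z (.count true) [Z] 0
  | one (d Z) : WalkRule (.count d) (.letter .one) Z (.count d) [.mark, Z] 1
  -- The cell that ends the offset may be the next vertex marker; the step to the left brings the
  -- head back inside the block.
  | counted {a} (d Z) : a ≠ .letter .one → WalkRule (.count d) a Z (.back d) [Z] (-1)
  | back {a} (d Z) : a ≠ .vmark → WalkRule (.back d) (.letter a) Z (.back d) [Z] (-1)
  | returned (d Z) : WalkRule (.back d) (.letter .vmark) Z (.jump d) [Z] 0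
  | jump {a} (d) : IsMarker a →
      WalkRule (.jump d) a .mark (.seek (turn a d)) [] (dirSign (turn a d))
  -- When the marks are used up on an endmarker, no rule applies: edges to virtual vertices lead
  -- nowhere.
  | arrived {Z} (d) : Z ≠ .mark → WalkRule (.jump d) (.letter .vmark) Z .vertex [Z] 0
  | seek {a} (d Z) : a ≠ .vmark → WalkRule (.seek d) (.letter a) Z (.seek d) [Z] (dirSign d)
  | found {a} (d Z) : IsMarker a → WalkRule (.seek d) a Z (.jump d) [Z] 0

lemma finite_of_forall_mem {α : Type} (l : List α) (h : ∀ x, x ∈ l) : Finite α :=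
  Set.finite_univ_iff.1 ((List.finite_toSet l).subset fun x _ => h x)

instance : Finite WalkSym :=
  finite_of_forall_mem [.bottom, .mark, .br true, .br false] fun x => by
    rcases x with _ | _ | ⟨_ | _⟩ <;> simp

instance : Finite CheckState :=
  finite_of_forall_mem [.first, .vertex, .bracket, .minus, .ones, .sep] fun x => by
    cases x <;> simp

instance : Finite WalkState := by
  have h : Function.Surjective fun x : Fin 6 ⊕ CheckState ⊕ Fin 4 × Bool =>
      match x with
      | .inl i => ![WalkState.start, .rewind, .vertex, .scan, .sign, .finish] i
      | .inr (.inl f) => .check f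
      | .inr (.inr (i, d)) => ![WalkState.count d, .back d, .jump d, .seek d] i := by
    intro x
    cases x with
    | start => exact ⟨.inl 0, rfl⟩
    | rewind => exact ⟨.inl 1, rfl⟩
    | vertex => exact ⟨.inl 2, rfl⟩
    | scan => exact ⟨.inl 3, rfl⟩
    | sign => exact ⟨.inl 4, rfl⟩
    | finish => exact ⟨.inl 5, rfl⟩
    | check f => exact ⟨.inr (.inl f), rfl⟩
    | count d => exact ⟨.inr (.inr (0, d)), rfl⟩
    | back d => exact ⟨.inr (.inr (1, d)), rfl⟩
    | jump d => exact ⟨.inr (.inr (2, d)), rfl⟩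
    | seek d => exact ⟨.inr (.inr (3, d)), rfl⟩
  exact Finite.of_surjective _ h

instance : Finite HardSym := by
  have h : Function.Surjective fun x : Br ⊕ Fin 4 =>
      match x with
      | .inl b => HardSym.bracket b
      | .inr i => ![HardSym.vmark, .one, .minus, .sep] i := by
    intro x
    cases x with
    | bracket b => exact ⟨.inl b, rfl⟩
    | vmark => exact ⟨.inr 0, rfl⟩
    | one => exact ⟨.inr 1, rfl⟩
    | minus => exact ⟨.inr 2, rfl⟩
    | sep => exact ⟨.inr 3, rfl⟩
  exact Finite.of_surjective _ h

instance : Finite (TapeCell HardSym) := by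
  have h : Function.Surjective fun x : HardSym ⊕ Bool =>
      match x with
      | .inl a => TapeCell.letter a
      | .inr true => .leftEnd
      | .inr false => .rightEnd := by
    intro x
    cases x with
    | letter a => exact ⟨.inl a, rfl⟩
    | leftEnd => exact ⟨.inr true, rfl⟩
    | rightEnd => exact ⟨.inr false, rfl⟩
  exact Finite.of_surjective _ h

lemma WalkRule.length_le {q a Z q' u d} (h : WalkRule q a Z q' u d) : u.length ≤ 2 := by
  cases h <;> simp

/-- The automaton for Dyck-2 reachability in graphs with relative edge addresses. -/
def walkAutomaton : TwoNPDA HardSym where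
  State := WalkState
  StackSym := WalkSym
  finite_state := inferInstance
  finite_stackSym := inferInstance
  start := .start
  final := {.finish}
  bottom := .bottom
  trans := {t | WalkRule t.1 t.2.1 t.2.2.1 t.2.2.2.1 t.2.2.2.2.1 t.2.2.2.2.2}
  finite_trans :=
    ((Set.finite_univ (α := WalkState)).prod ((Set.finite_univ (α := TapeCell HardSym)).prod
      ((Set.finite_univ (α := WalkSym)).prod ((Set.finite_univ (α := WalkState)).prod
        ((List.finite_length_le WalkSym 2).prod (Set.finite_univ (α := SignType))))))).subset
      fun _ ht => ⟨trivial, trivial, trivial, trivial, WalkRule.length_le ht, trivial⟩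
  trans_bottom := by
    intro q a q' u d h
    change WalkRule q a .bottom q' u d at h
    generalize hZ : WalkSym.bottom = Z at h ⊢
    subst_vars
    cases h with
    | push k => exact ⟨[.br k], rfl, by simp⟩
    | one => exact ⟨[.mark], rfl, by simp⟩
    | _ => exact ⟨[], rfl, by simp⟩
  trans_other := by
    intro q a Z q' u d h hZ
    change WalkRule q a Z q' u d at h
    cases h <;> simp [hZ.symm]

namespace WalkAutomaton

open RelGraph

/-- The stack with `j` marks above the open brackets `s`. -/
def walkStack (j : ℕ) (s : List Bool) : List WalkSym :=
  List.replicate j .mark ++ (s.map .br ++ [.bottom])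

lemma walkStack_ne_nil (j : ℕ) (s : List Bool) : walkStack j s ≠ [] := by
  simp [walkStack]

lemma walkStack_succ (j : ℕ) (s : List Bool) : walkStack (j + 1) s = .mark :: walkStack j s := rfl

lemma walkStack_zero_cons (k : Bool) (s : List Bool) :
    walkStack 0 (k :: s) = .br k :: walkStack 0 s := rfl

lemma eq_succ_of_walkStack_eq_mark {j : ℕ} {s : List Bool} {l : List WalkSym}
    (h : walkStack j s = .mark :: l) : ∃ i, j = i + 1 ∧ l = walkStack i s := by
  cases j with
  | zero => cases s <;> simp [walkStack] at h
  | succ i => exact ⟨i, rfl, (List.cons.inj h).2.symm⟩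

lemma eq_zero_of_walkStack_eq {j : ℕ} {s : List Bool} {Z : WalkSym} {l : List WalkSym}
    (h : walkStack j s = Z :: l) (hZ : Z ≠ .mark) : j = 0 := by
  cases j with
  | zero => rfl
  | succ i => exact absurd (List.cons.inj h).1.symm hZ

lemma eq_cons_of_walkStack_eq_br {s : List Bool} {k : Bool} {l : List WalkSym}
    (h : walkStack 0 s = .br k :: l) : ∃ s', s = k :: s' ∧ l = walkStack 0 s' := by
  cases s with
  | nil => simp [walkStack] at h
  | cons k' s =>
    rw [walkStack_zero_cons] at h
    injection h with h1 h2
    injection h1 with h1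
    exact ⟨s, by rw [h1], h2.symm⟩

/-! ### Head movement between markers. -/

section Positions

variable {G : RelGraph}

/-- The head at tape position `x` is on its way to the marker with number `p`, in direction `d`. -/
def Approach (G : RelGraph) : Bool → ℕ → ℕ → Prop
  | true, p, x => ∃ q ≤ G.length, p = q + 1 ∧ G.markerPos q < x ∧ x ≤ G.markerPos (q + 1)
  | false, p, x => p ≤ G.length ∧ G.markerPos p ≤ x ∧ x < G.markerPos (p + 1)

lemma Approach.le {d : Bool} {p x : ℕ} (h : Approach G d p x) : p ≤ G.length + 1 := by
  cases d
  · exact h.1.trans (Nat.le_succ _)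
  · obtain ⟨q, hq, rfl, -⟩ := h
    omega

lemma Approach.lt {d : Bool} {p x : ℕ} (h : Approach G d p x) : x < G.codeTape.length := by
  cases d
  · exact h.2.2.trans (markerPos_lt_length (by have := h.1; omega))
  · obtain ⟨q, hq, rfl, -, h⟩ := h
    exact h.trans_lt (markerPos_lt_length (by omega))

/-- The interval of positions allowed by `Approach` contains only one marker, its target. -/
lemma eq_markerPos_of_isMarker {d : Bool} {p x : ℕ} {a : TapeCell HardSym}
    (h : Approach G d p x) (ha : G.codeTape[x]? = some a) (hm : IsMarker a) :
    x = G.markerPos p := by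
  have key : ∀ q ≤ G.length, G.markerPos q < x → x < G.markerPos (q + 1) → False := by
    intro q hq h1 h2
    obtain ⟨c, hc, hc'⟩ := exists_letter_between hq h1 h2
    rw [hc'] at ha
    obtain rfl := Option.some.inj ha
    cases hm
    exact hc rfl
  cases d
  · obtain ⟨h1, h2, h3⟩ := h
    exact (h2.eq_or_lt.resolve_right fun h => key p h1 h h3).symm
  · obtain ⟨q, h1, rfl, h2, h3⟩ := h
    exact h3.eq_or_lt.resolve_right fun h => key q h1 h2 h

lemma ne_markerPos_of_ne_vmark {p x : ℕ} {a : HardSym} (hp : p ≤ G.length + 1)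
    (ha : G.codeTape[x]? = some (.letter a)) (hv : a ≠ .vmark) : x ≠ G.markerPos p := by
  rintro rfl
  obtain ⟨a', hm, ha'⟩ := exists_marker (G := G) hp
  rw [ha'] at ha
  obtain rfl := Option.some.inj ha
  cases hm
  exact hv rfl

lemma Approach.step {d : Bool} {p x x' : ℕ} {a : HardSym} (h : Approach G d p x)
    (ha : G.codeTape[x]? = some (.letter a)) (hv : a ≠ .vmark)
    (hx : (x' : ℤ) = (x : ℤ) + (dirSign d : ℤ)) : Approach G d p x' := by
  have hne := ne_markerPos_of_ne_vmark h.le ha hv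
  cases d
  · obtain ⟨h1, h2, h3⟩ := h
    simp only [dirSign, SignType.coe_neg_one] at hx
    exact ⟨h1, by omega, by omega⟩
  · obtain ⟨q, h1, rfl, h2, h3⟩ := h
    simp only [dirSign, SignType.coe_one] at hx
    exact ⟨q, h1, rfl, by omega, by omega⟩

/-- `scrollStep` turns by testing the position number, the automaton by reading the endmarker. Both
turn before moving, so leaving a marker corresponds to exactly one scroll step. -/
lemma Approach.of_turn {d : Bool} {p x : ℕ} {a : TapeCell HardSym} (hp : p ≤ G.length + 1)
    (ha : G.codeTape[G.markerPos p]? = some a)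
    (hx : (x : ℤ) = (G.markerPos p : ℤ) + (dirSign (turn a d) : ℤ)) :
    Approach G (turn a d) (scrollStep G.length (p, d)).1 x ∧
      (scrollStep G.length (p, d)).2 = turn a d := by
  have hlast : p = G.length + 1 → a = .rightEnd := by
    rintro rfl
    rw [getElem?_markerPos_last] at ha
    exact (Option.some.inj ha).symm
  have hfirst : p = 0 → a = .leftEnd := by
    rintro rfl
    rw [getElem?_markerPos_zero] at ha
    exact (Option.some.inj ha).symm
  have hmid : p ≠ 0 → p ≤ G.length → a = .letter .vmark := by
    intro h1 h2
    obtain ⟨i, rfl⟩ := Nat.exists_eq_succ_of_ne_zero h1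
    rw [getElem?_markerPos_succ h2] at ha
    exact (Option.some.inj ha).symm
  have right : p ≤ G.length → (x : ℤ) = (G.markerPos p : ℤ) + 1 → Approach G true (p + 1) x := by
    intro h1 h2
    have := markerPos_lt_succ h1
    exact ⟨p, h1, rfl, by omega, by omega⟩
  have left : p ≠ 0 → (x : ℤ) = (G.markerPos p : ℤ) - 1 → Approach G false (p - 1) x := by
    intro h1 h2
    obtain ⟨i, rfl⟩ := Nat.exists_eq_succ_of_ne_zero h1
    have := markerPos_lt_succ (G := G) (p := i) (by omega)
    simp only [Nat.succ_eq_add_one, Nat.add_sub_cancel] at h2 ⊢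
    exact ⟨by omega, by omega, by omega⟩
  by_cases h0 : p = 0
  · obtain rfl := hfirst h0
    simp only [turn, dirSign, SignType.coe_one] at hx
    have := right (by omega) hx
    subst h0
    cases d
    · exact ⟨this, rfl⟩
    · rw [scrollStep, if_neg (by omega)]
      exact ⟨this, rfl⟩
  · by_cases h1 : p = G.length + 1
    · obtain rfl := hlast h1
      simp only [turn, dirSign, SignType.coe_neg_one] at hx
      have := left h0 hx
      cases d
      · rw [scrollStep, if_neg h0]
        exact ⟨this, rfl⟩
      · rw [scrollStep, if_pos (by omega)]
        rw [h1, Nat.add_sub_cancel] at this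
        exact ⟨this, rfl⟩
    · obtain rfl := hmid h0 (by omega)
      cases d
      · simp only [turn, dirSign, SignType.coe_neg_one] at hx
        rw [scrollStep, if_neg h0]
        exact ⟨left h0 hx, rfl⟩
      · simp only [turn, dirSign, SignType.coe_one] at hx
        rw [scrollStep, if_neg (by omega)]
        exact ⟨right (by omega) hx, rfl⟩

end Positions

/-! ### Accepted inputs are codes of yes-instances. -/

section Soundness

/-- A checked input is the code of a nonempty graph. -/
def CheckedInv (w : List HardSym) (c : walkAutomaton.Config) : Prop :=
  match c.state with
  | .start => True
  | .check f => ∃ t, c.pos = t + 1 ∧ CheckState.first.run (w.take t) = some f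
  | _ => ∃ f, CheckState.first.run w = some f ∧ f.Accepting

lemma checkedInv_of_step {w : List HardSym} {c c' : walkAutomaton.Config}
    (h : CheckedInv w c) (hs : walkAutomaton.Step w c c') : CheckedInv w c' := by
  obtain ⟨q, x, st⟩ := c
  obtain ⟨q', x', st'⟩ := c'
  obtain ⟨a, Z, rest, u, d, hr, ha, hst, hst', hx, hlt⟩ := hs
  change WalkRule q a Z q' u d at hr
  dsimp only at ha hx
  cases hr
  case start =>
    obtain rfl := TwoNPDA.getElem?_tape_eq_leftEnd ha
    exact ⟨0, by change x' = _; simp at hx; omega, rfl⟩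
  case check f f' a hf =>
    obtain ⟨t, rfl, ht⟩ := h
    obtain ⟨j, hj, hw⟩ := TwoNPDA.getElem?_tape_eq_letter ha
    obtain rfl : j = t := (Nat.succ.inj hj).symm
    refine ⟨j + 1, by change x' = _; simp at hx; omega, ?_⟩
    rw [List.take_add_one, hw, CheckState.run_append, ht]
    simp [CheckState.run_cons, hf, CheckState.run_nil]
  case checked f hf =>
    obtain ⟨t, rfl, ht⟩ := h
    have := TwoNPDA.getElem?_tape_eq_rightEnd ha
    rw [List.take_of_length_le (Nat.succ.inj this).ge] at ht
    exact ⟨f, ht, hf⟩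
  -- Once the check is over, the invariant concerns the input alone.
  all_goals exact h

variable {G : RelGraph}

/-- The vertex with index `i` is reachable with the stack `s` of open brackets. -/
def Reach (G : RelGraph) (i : ℕ) (s : List Bool) : Prop :=
  ∃ (h0 : 0 < G.length) (hi : i < G.length),
    Relation.ReflTransGen (StackStep G.Edge) (⟨0, h0⟩, []) (⟨i, hi⟩, s)

/-- The vertex that a head at position `p` with direction `d` reaches by `j` moves, if it is one, is
reachable with the stack `s` of open brackets. -/
def Pending (G : RelGraph) (p : ℕ) (d : Bool) (j : ℕ) (s : List Bool) : Prop :=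
  ∀ i < G.length, ((scrollStep G.length)^[j] (p, d)).1 = i + 1 → Reach G i s

lemma pending_of_edgeAt {i y : ℕ} {b : Br} {k : ℤ} {s s' : List Bool} (he : G.EdgeAt i y b k)
    (h : Reach G i s) (hb : b.Act s s') : Pending G (i + 1) (decide (0 ≤ k)) k.natAbs s' := by
  intro j hj hd
  obtain ⟨h0, hi, hr⟩ := h
  obtain ⟨_, hk⟩ := he.mem
  -- By definition, `destination` is the iterate in `Pending`, so `hd` is the address condition of
  -- the edge.
  exact ⟨h0, hj, hr.tail ⟨b, ⟨k, hk, hd⟩, hb⟩⟩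

/-- The invariant of the walk. -/
def WalkInv (G : RelGraph) (c : walkAutomaton.Config) : Prop :=
  match c.state with
  | .start => c.stack = walkStack 0 []
  | .check _ => c.stack = walkStack 0 []
  | .rewind => c.stack = walkStack 0 []
  | .vertex => ∃ i s, i < G.length ∧ c.pos = G.markerPos (i + 1) ∧ c.stack = walkStack 0 s ∧
      Reach G i s
  | .scan => ∃ i s, Approach G true (i + 2) c.pos ∧ c.stack = walkStack 0 s ∧ Reach G i s
  | .finish => ∃ i s, Approach G true (i + 2) c.pos ∧ c.stack = walkStack 0 s ∧ Reach G i s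
  | .sign => ∃ i y b k s, G.EdgeAt i y b k ∧ c.pos = y + 1 ∧ c.stack = walkStack 0 s ∧
      Pending G (i + 1) (decide (0 ≤ k)) k.natAbs s
  | .count d => ∃ i y b k s t, G.EdgeAt i y b k ∧ c.pos = digitsPos y k + t ∧ t ≤ k.natAbs ∧
      c.stack = walkStack t s ∧ d = decide (0 ≤ k) ∧ Pending G (i + 1) d k.natAbs s
  | .back d => ∃ i j s, Approach G false (i + 1) c.pos ∧ c.stack = walkStack j s ∧
      Pending G (i + 1) d j s
  | .jump d => ∃ p j s, p ≤ G.length + 1 ∧ c.pos = G.markerPos p ∧ c.stack = walkStack j s ∧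
      Pending G p d j s
  | .seek d => ∃ p j s, Approach G d p c.pos ∧ c.stack = walkStack j s ∧ Pending G p d j s

lemma approach_succ {i x : ℕ} (hi : i < G.length)
    (hx : (x : ℤ) = (G.markerPos (i + 1) : ℤ) + 1) : Approach G true (i + 2) x := by
  have := markerPos_lt_succ (G := G) (p := i + 1) hi
  exact ⟨i + 1, hi, rfl, by omega, by omega⟩

lemma walkInv_of_step (hG : G ≠ []) {c c' : walkAutomaton.Config} (h : WalkInv G c)
    (hs : walkAutomaton.Step G.encode c c') : WalkInv G c' := by
  obtain ⟨q, x, st⟩ := c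
  obtain ⟨q', x', st'⟩ := c'
  obtain ⟨a, Z, rest, u, d, hr, ha, hst, hst', hx, hlt⟩ := hs
  change WalkRule q a Z q' u d at hr
  dsimp only at ha hx hst hst'
  subst hst hst'
  have hn : 0 < G.length := List.length_pos_iff.2 hG
  cases hr
  case start => exact h
  case check => exact h
  case checked => exact h
  case rewind => exact h
  case rewound =>
    obtain rfl := TwoNPDA.getElem?_tape_eq_leftEnd ha
    refine ⟨0, [], hn, ?_, h, hn, hn, .refl⟩
    simp [markerPos, RelGraph.encode] at hx ⊢
    omega
  case depart =>
    obtain ⟨i, s, hi, rfl, hst, hr⟩ := h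
    exact ⟨i, s, approach_succ hi (by simpa using hx), hst, hr⟩
  case finish =>
    obtain ⟨i, s, hi, rfl, hst, hr⟩ := h
    exact ⟨i, s, approach_succ hi (by simpa using hx), hst, hr⟩
  case finishSkip a ha' =>
    obtain ⟨i, s, hA, hst, hr⟩ := h
    exact ⟨i, s, hA.step ha ha' hx, hst, hr⟩
  case scan a ha' =>
    obtain ⟨i, s, hA, hst, hr⟩ := h
    exact ⟨i, s, hA.step ha ha' hx, hst, hr⟩
  case push k =>
    obtain ⟨i, s, hA, hst, hr⟩ := h
    obtain ⟨-, hi, -⟩ := id hr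
    have hne := ne_markerPos_of_ne_vmark hA.le ha (by simp)
    obtain ⟨_, -, hq, h1, h2⟩ := hA
    obtain rfl := Nat.succ.inj hq
    obtain ⟨o, he⟩ := exists_edgeAt_of_getElem? hi h1 (h2.lt_of_ne hne) ha
    exact ⟨i, x, _, o, k :: s, he, by change x' = _; simp at hx; omega,
      by rw [walkStack_zero_cons, ← hst]; rfl, pending_of_edgeAt he hr (.push k s)⟩
  case pop k =>
    obtain ⟨i, s, hA, hst, hr⟩ := h
    obtain ⟨s, rfl, rfl⟩ := eq_cons_of_walkStack_eq_br hst.symm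
    obtain ⟨-, hi, -⟩ := id hr
    have hne := ne_markerPos_of_ne_vmark hA.le ha (by simp)
    obtain ⟨_, -, hq, h1, h2⟩ := hA
    obtain rfl := Nat.succ.inj hq
    obtain ⟨o, he⟩ := exists_edgeAt_of_getElem? hi h1 (h2.lt_of_ne hne) ha
    exact ⟨i, x, _, o, s, he, by change x' = _; simp at hx; omega, rfl,
      pending_of_edgeAt he hr (.pop k s)⟩
  case minus =>
    obtain ⟨i, y, b, k, s, he, rfl, hst, hP⟩ := h
    -- If `k` is not negative, the cell after the label is a digit or the terminator, neither of
    -- which is a minus sign.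
    have hk : k < 0 := by
      by_contra hk
      have hD : digitsPos y k = y + 1 := if_neg hk
      by_cases h0 : k = 0
      · obtain ⟨a, ha', -, hm⟩ := he.terminator
        rw [hD, h0, Int.natAbs_zero, Nat.add_zero, ha] at ha'
        exact hm (Option.some.inj ha').symm
      · have := he.digit 0 (by omega)
        rw [hD, Nat.add_zero, ha] at this
        simp at this
    have hd : decide (0 ≤ k) = false := decide_eq_false (by omega)
    refine ⟨i, y, b, k, s, 0, he, ?_, Nat.zero_le _, hst, hd.symm, hd ▸ hP⟩
    simp [digitsPos, hk] at hx ⊢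
    omega
  case plus ha' =>
    obtain ⟨i, y, b, k, s, he, rfl, hst, hP⟩ := h
    have hk : ¬ k < 0 := fun hk => ha' (Option.some.inj (ha.symm.trans (he.sign hk)))
    have hd : decide (0 ≤ k) = true := decide_eq_true (by omega)
    refine ⟨i, y, b, k, s, 0, he, ?_, Nat.zero_le _, hst, hd.symm, hd ▸ hP⟩
    simp [digitsPos, hk] at hx ⊢
    omega
  case one d =>
    obtain ⟨i, y, b, k, s, t, he, rfl, ht, hst, hd, hP⟩ := h
    have htk : t ≠ k.natAbs := by
      rintro rfl
      obtain ⟨a, ha', hm, -⟩ := he.terminator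
      exact hm (Option.some.inj (ha'.symm.trans ha))
    refine ⟨i, y, b, k, s, t + 1, he, ?_, by omega, ?_, hd, hP⟩
    · simp at hx ⊢
      omega
    · rw [walkStack_succ, ← hst]
      rfl
  case counted d ha' =>
    obtain ⟨i, y, b, k, s, t, he, rfl, ht, hst, hd, hP⟩ := h
    -- A cell other than a digit can only be the terminator, so the whole offset has been counted.
    obtain rfl : t = k.natAbs := by
      by_contra htk
      exact ha' (Option.some.inj (ha.symm.trans (he.digit t (by omega))))
    have h1 := he.lower
    have h2 := he.upper
    obtain ⟨hi, -⟩ := he.mem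
    have hD : y + 1 ≤ digitsPos y k := by
      rw [digitsPos]
      split_ifs <;> omega
    simp only [SignType.coe_neg_one] at hx
    refine ⟨i, k.natAbs, s, ⟨hi, ?_, ?_⟩, hst, hP⟩
    · change _ ≤ x'
      omega
    · change x' < G.markerPos (i + 2)
      omega
  case back d a ha' =>
    obtain ⟨i, j, s, hA, hst, hP⟩ := h
    exact ⟨i, j, s, hA.step ha ha' hx, hst, hP⟩
  case returned d =>
    obtain ⟨i, j, s, hA, hst, hP⟩ := h
    have := eq_markerPos_of_isMarker hA ha .vmark
    exact ⟨i + 1, j, s, hA.le, by change x' = _; simp at hx this; omega, hst, hP⟩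
  case jump d hm =>
    obtain ⟨p, j, s, hp, rfl, hst, hP⟩ := h
    obtain ⟨j, rfl, rfl⟩ := eq_succ_of_walkStack_eq_mark hst.symm
    obtain ⟨hA, hd⟩ := Approach.of_turn (d := d) hp ha hx
    -- Removing one mark pays for one scroll step, so the final destination is unchanged.
    refine ⟨_, j, s, hA, rfl, fun i hi hi' => hP i hi ?_⟩
    rw [Function.iterate_succ_apply, ← hi', ← hd]
  case arrived d hZ =>
    obtain ⟨p, j, s, hp, rfl, hst, hP⟩ := h
    obtain rfl := eq_zero_of_walkStack_eq hst.symm hZ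
    have hp0 : p ≠ 0 := by
      rintro rfl
      rw [getElem?_markerPos_zero] at ha
      simp at ha
    obtain ⟨i, rfl⟩ := Nat.exists_eq_succ_of_ne_zero hp0
    have hi : i < G.length := by
      by_contra hi
      obtain rfl : i = G.length := by omega
      rw [Nat.succ_eq_add_one, getElem?_markerPos_last] at ha
      simp at ha
    exact ⟨i, s, hi, by change x' = _; simp at hx; omega, hst, hP i hi rfl⟩
  case seek d a ha' =>
    obtain ⟨p, j, s, hA, hst, hP⟩ := h
    exact ⟨p, j, s, hA.step ha ha' hx, hst, hP⟩
  case found d hm =>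
    obtain ⟨p, j, s, hA, hst, hP⟩ := h
    have := eq_markerPos_of_isMarker hA ha hm
    exact ⟨p, j, s, hA.le, by change x' = _; simp at hx this; omega, hst, hP⟩

lemma exists_eq_encode_of_accepts {w : List HardSym} (h : walkAutomaton.Accepts w) :
    ∃ G : RelGraph, w = G.encode ∧ G ≠ [] := by
  obtain ⟨q, rfl, hr⟩ := h
  have h1 : ∀ c c', CheckedInv w c → Relation.ReflTransGen (walkAutomaton.Step w) c c' →
      CheckedInv w c' := by
    intro c c' hc h
    induction h with
    | refl => exact hc
    | tail _ hs ih => exact checkedInv_of_step ih hs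
  obtain ⟨f, hf, hacc⟩ := h1 ⟨.start, 0, [.bottom]⟩ _ trivial hr
  exact CheckState.exists_encode_of_run hf hacc

lemma yesInstance_of_accepts (hG : G ≠ []) (h : walkAutomaton.Accepts G.encode) :
    G.YesInstance := by
  obtain ⟨q, rfl, hr⟩ := h
  have h2 : ∀ c c', WalkInv G c → Relation.ReflTransGen (walkAutomaton.Step G.encode) c c' →
      WalkInv G c' := by
    intro c c' hc h
    induction h with
    | refl => exact hc
    | tail _ hs ih => exact walkInv_of_step hG ih hs
  obtain ⟨i, s, hA, hs, h0, hi, hreach⟩ := h2 ⟨.start, 0, [.bottom]⟩ _ rfl hr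
  -- The final stack is the bottom symbol alone, so no bracket is left open.
  obtain rfl : s = [] := by
    cases s with
    | nil => rfl
    | cons k s => simp [walkStack, walkAutomaton] at hs
  obtain ⟨_, -, hq, h1, h2⟩ := hA
  obtain rfl := Nat.succ.inj hq
  -- The head is on the right endmarker and has not passed the marker after vertex `i`, so that
  -- marker is the right endmarker.
  replace h2 : G.markerPos (G.length + 1) ≤ G.markerPos (i + 2) := by
    rw [markerPos_length]
    exact h2
  have hlast : i = G.length - 1 := by
    by_contra hne
    have h3 := markerPos_le_of_le (G := G) (p := i + 2) (q := G.length) (by omega) (by omega)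
    have h4 := markerPos_lt_succ (le_refl G.length)
    omega
  subst hlast
  exact ⟨h0, dyckTwoReach_iff.2 hreach⟩

end Soundness

/-! ### Codes of yes-instances are accepted. -/

section Completeness

lemma step {w : List HardSym} {q : WalkState} {a : TapeCell HardSym} {Z : WalkSym}
    {q' : WalkState} {u : List WalkSym} {d : SignType} (h : WalkRule q a Z q' u d) {x x' : ℕ}
    (ha : (TwoNPDA.tape w)[x]? = some a) (hx : (x' : ℤ) = (x : ℤ) + (d : ℤ))
    (hlt : x' < (TwoNPDA.tape w).length) (rest : List WalkSym) :
    walkAutomaton.Step w ⟨q, x, Z :: rest⟩ ⟨q', x', u ++ rest⟩ :=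
  ⟨a, Z, rest, u, d, h, ha, rfl, rfl, hx, hlt⟩

lemma step_keep {w : List HardSym} {q : WalkState} {a : TapeCell HardSym}
    {q' : WalkState} {d : SignType} (h : ∀ Z, WalkRule q a Z q' [Z] d) {x x' : ℕ}
    (ha : (TwoNPDA.tape w)[x]? = some a) (hx : (x' : ℤ) = (x : ℤ) + (d : ℤ))
    (hlt : x' < (TwoNPDA.tape w).length) (j : ℕ) (s : List Bool) :
    walkAutomaton.Step w ⟨q, x, walkStack j s⟩ ⟨q', x', walkStack j s⟩ := by
  obtain ⟨Z, rest, h'⟩ := List.exists_cons_of_ne_nil (walkStack_ne_nil j s)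
  rw [h']
  exact step (h Z) ha hx hlt rest

lemma runs_check {w : List HardSym} (v : List HardSym) {u : List HardSym} {f f' : CheckState}
    (hw : w = u ++ v) (hf : f.run v = some f') :
    Relation.ReflTransGen (walkAutomaton.Step w) ⟨.check f, u.length + 1, walkStack 0 []⟩
      ⟨.check f', w.length + 1, walkStack 0 []⟩ := by
  induction v generalizing u f with
  | nil =>
    obtain rfl : f = f' := by simpa [CheckState.run_nil] using hf
    obtain rfl : w = u := by simpa using hw
    exact .refl
  | cons a v ih =>
    rw [CheckState.run_cons, Option.bind_eq_some_iff] at hf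
    obtain ⟨f₁, h1, h2⟩ := hf
    have := ih (u := u ++ [a]) (by simp [hw]) h2
    rw [List.length_append, List.length_singleton] at this
    have hlen : u.length < w.length := by simp [hw]
    refine .head (step_keep (fun Z => .check Z h1) ?_ (by simp)
      (by rw [TwoNPDA.length_tape]; omega) 0 []) this
    rw [TwoNPDA.getElem?_tape_succ w hlen]
    simp [hw]

lemma runs_rewind {w : List HardSym} {x : ℕ} (hx : x ≤ w.length) :
    Relation.ReflTransGen (walkAutomaton.Step w) ⟨.rewind, x, walkStack 0 []⟩
      ⟨.rewind, 0, walkStack 0 []⟩ := by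
  induction x with
  | zero => exact .refl
  | succ x ih =>
    exact .head (step_keep (fun Z => .rewind _ Z) (TwoNPDA.getElem?_tape_succ w hx) (by simp)
      (by rw [TwoNPDA.length_tape]; omega) 0 []) (ih (by omega))

variable {G : RelGraph}

lemma runs_right {q : WalkState}
    (hq : ∀ a Z, a ≠ HardSym.vmark → WalkRule q (.letter a) Z q [Z] 1) {p x y : ℕ}
    (hp : p ≤ G.length) (hx : G.markerPos p < x) (hxy : x ≤ y) (hy : y ≤ G.markerPos (p + 1))
    (j : ℕ) (s : List Bool) :
    Relation.ReflTransGen (walkAutomaton.Step G.encode) ⟨q, x, walkStack j s⟩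
      ⟨q, y, walkStack j s⟩ := by
  induction y, hxy using Nat.le_induction with
  | base => exact .refl
  | succ y hxy ih =>
    obtain ⟨a, ha, ha'⟩ := exists_letter_between hp (x := y) (by omega) (by omega)
    exact (ih (by omega)).tail (step_keep (fun Z => hq a Z ha) ha' (by simp)
      (hy.trans_lt (markerPos_lt_length (by omega))) j s)

lemma runs_left {q : WalkState}
    (hq : ∀ a Z, a ≠ HardSym.vmark → WalkRule q (.letter a) Z q [Z] (-1)) {p x : ℕ}
    (hp : p ≤ G.length) (hx : G.markerPos p ≤ x) (hx' : x < G.markerPos (p + 1))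
    (j : ℕ) (s : List Bool) :
    Relation.ReflTransGen (walkAutomaton.Step G.encode) ⟨q, x, walkStack j s⟩
      ⟨q, G.markerPos p, walkStack j s⟩ := by
  induction x, hx using Nat.le_induction with
  | base => exact .refl
  | succ x hx ih =>
    obtain ⟨a, ha, ha'⟩ := exists_letter_between hp (x := x + 1) (by omega) (by omega)
    exact .head (step_keep (fun Z => hq a Z ha) ha' (by simp)
      (by have := markerPos_lt_length (G := G) (p := p + 1) (by omega)
          change _ < G.codeTape.length; omega) j s) (ih (by omega))

lemma runs_seek {d : Bool} {p x : ℕ} (h : Approach G d p x) (j : ℕ) (s : List Bool) :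
    Relation.ReflTransGen (walkAutomaton.Step G.encode) ⟨.seek d, x, walkStack j s⟩
      ⟨.jump d, G.markerPos p, walkStack j s⟩ := by
  obtain ⟨a, hm, ha⟩ := exists_marker h.le
  refine Relation.ReflTransGen.tail (b := ⟨.seek d, G.markerPos p, walkStack j s⟩) ?_
    (step_keep (fun Z => .found d Z hm) ha (by simp) (markerPos_lt_length h.le) j s)
  cases d
  · exact runs_left (fun a Z ha => .seek false Z ha) h.1 h.2.1 h.2.2 j s
  · obtain ⟨q, hq, rfl, h1, h2⟩ := h
    exact runs_right (fun a Z ha => .seek true Z ha) hq h1 h2 le_rfl j s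

/-- Induction on the number of marks: each is spent on one scroll step, followed by a run to the
next marker. The final direction is irrelevant, since it is forgotten on arrival. -/
lemma runs_jump {d : Bool} {p j : ℕ} (hp : p ≤ G.length + 1) (s : List Bool) :
    ∃ d', Relation.ReflTransGen (walkAutomaton.Step G.encode)
      ⟨.jump d, G.markerPos p, walkStack j s⟩
      ⟨.jump d', G.markerPos ((scrollStep G.length)^[j] (p, d)).1, walkStack 0 s⟩ := by
  induction j generalizing p d with
  | zero => exact ⟨d, .refl⟩
  | succ j ih =>
    obtain ⟨a, hm, ha⟩ := exists_marker hp
    -- A move to the left never starts at position `0`, because the left endmarker turns the head to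
    -- the right.
    obtain ⟨x, hx⟩ : ∃ x : ℕ, (x : ℤ) = (G.markerPos p : ℤ) + (dirSign (turn a d) : ℤ) := by
      rcases hd : turn a d with _ | _
      · refine ⟨G.markerPos p - 1, ?_⟩
        have h0 : G.markerPos p ≠ 0 := by
          intro h0
          rw [h0] at ha
          obtain rfl : TapeCell.leftEnd = a := Option.some.inj ha
          simp [turn] at hd
        simp only [dirSign, SignType.coe_neg_one]
        omega
      · exact ⟨G.markerPos p + 1, by simp [dirSign]⟩
    obtain ⟨hA, hd⟩ := Approach.of_turn (d := d) hp ha hx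
    obtain ⟨d', h'⟩ := ih (p := (scrollStep G.length (p, d)).1) (d := turn a d) hA.le
    refine ⟨d', .head (step (.jump d hm) ha hx hA.lt _) ((runs_seek hA j s).trans ?_)⟩
    rw [Function.iterate_succ_apply]
    rwa [show (scrollStep G.length (p, d)) = ((scrollStep G.length (p, d)).1, turn a d) by rw [← hd]]

lemma runs_count {i y : ℕ} {b : Br} {k : ℤ} (he : G.EdgeAt i y b k) (d : Bool) (s : List Bool)
    {t : ℕ} (ht : t ≤ k.natAbs) :
    Relation.ReflTransGen (walkAutomaton.Step G.encode)
      ⟨.count d, digitsPos y k, walkStack 0 s⟩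
      ⟨.count d, digitsPos y k + t, walkStack t s⟩ := by
  obtain ⟨hi, -⟩ := he.mem
  have hlt := he.upper.trans_lt (markerPos_lt_length (G := G) (p := i + 2) (by omega))
  induction t with
  | zero => exact .refl
  | succ t ih =>
    refine (ih (by omega)).tail ?_
    obtain ⟨Z, rest, h'⟩ := List.exists_cons_of_ne_nil (walkStack_ne_nil t s)
    rw [walkStack_succ, h']
    exact step (.one d Z) (he.digit t (by omega)) (by simp; ring)
      (by change _ < G.codeTape.length; omega) rest

/-- The complete cycle from vertex to vertex. The bracket acts before the marks are pushed, so the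
marks lie above all open brackets and are gone when the next bracket acts. -/
lemma runs_edge {i y : ℕ} {b : Br} {k : ℤ} (he : G.EdgeAt i y b k) {s s' : List Bool}
    (hb : b.Act s s') {j : ℕ} (hj : j < G.length)
    (hd : destination G.length (i + 1) k = j + 1) :
    Relation.ReflTransGen (walkAutomaton.Step G.encode)
      ⟨.vertex, G.markerPos (i + 1), walkStack 0 s⟩
      ⟨.vertex, G.markerPos (j + 1), walkStack 0 s'⟩ := by
  obtain ⟨hi, -⟩ := he.mem
  have hlow := he.lower
  have hup := he.upper
  have hlen : G.markerPos (i + 2) < G.codeTape.length := markerPos_lt_length (by omega)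
  have hD : y + 1 ≤ digitsPos y k := by
    rw [digitsPos]
    split_ifs <;> omega
  have h1 : Relation.ReflTransGen (walkAutomaton.Step G.encode)
      ⟨.vertex, G.markerPos (i + 1), walkStack 0 s⟩ ⟨.scan, y, walkStack 0 s⟩ :=
    .head (step_keep (fun Z => .depart Z) (getElem?_markerPos_succ hi) (by simp)
      (by change _ < G.codeTape.length; omega) 0 s)
      (runs_right (fun a Z ha => .scan Z ha) (p := i + 1) (x := G.markerPos (i + 1) + 1) hi
        (by omega) (by omega) (by change y ≤ G.markerPos (i + 2); omega) 0 s)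
  have h2 : walkAutomaton.Step G.encode ⟨.scan, y, walkStack 0 s⟩
      ⟨.sign, y + 1, walkStack 0 s'⟩ := by
    have hl := he.label
    cases hb with
    | push k s =>
      obtain ⟨Z, rest, h'⟩ := List.exists_cons_of_ne_nil (walkStack_ne_nil 0 s)
      rw [walkStack_zero_cons, h']
      exact step (.push k Z) hl (by simp) (by change _ < G.codeTape.length; omega) rest
    | pop k s =>
      exact step (.pop k) hl (by simp) (by change _ < G.codeTape.length; omega) _
  have h3 : walkAutomaton.Step G.encode ⟨.sign, y + 1, walkStack 0 s'⟩
      ⟨.count (decide (0 ≤ k)), digitsPos y k, walkStack 0 s'⟩ := by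
    by_cases hk : k < 0
    · rw [decide_eq_false (by omega), show digitsPos y k = y + 2 from if_pos hk]
      rw [show digitsPos y k = y + 2 from if_pos hk] at hup
      exact step_keep (fun Z => .minus Z) (he.sign hk) (by push_cast; simp; ring)
        (by change _ < G.codeTape.length; omega) 0 s'
    · have hD' : digitsPos y k = y + 1 := if_neg hk
      rw [decide_eq_true (by omega), hD']
      obtain ⟨a, ha, hm⟩ : ∃ a, G.codeTape[y + 1]? = some a ∧ a ≠ .letter .minus := by
        by_cases h0 : k = 0
        · obtain ⟨a, ha, -, hm⟩ := he.terminator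
          rw [hD', h0, Int.natAbs_zero, Nat.add_zero] at ha
          exact ⟨a, ha, hm⟩
        · have := he.digit 0 (by omega)
          rw [hD', Nat.add_zero] at this
          exact ⟨_, this, by simp⟩
      exact step_keep (fun Z => .plus Z hm) ha (by simp)
        (by change _ < G.codeTape.length; omega) 0 s'
  have h4 := runs_count he (decide (0 ≤ k)) s' le_rfl
  have h5 : walkAutomaton.Step G.encode
      ⟨.count (decide (0 ≤ k)), digitsPos y k + k.natAbs, walkStack k.natAbs s'⟩
      ⟨.back (decide (0 ≤ k)), digitsPos y k + k.natAbs - 1, walkStack k.natAbs s'⟩ := by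
    obtain ⟨a, ha, hm, -⟩ := he.terminator
    exact step_keep (fun Z => .counted _ Z hm) ha (by simp only [SignType.coe_neg_one]; omega)
      (by change _ < G.codeTape.length; omega) _ s'
  have h6 : Relation.ReflTransGen (walkAutomaton.Step G.encode)
      ⟨.back (decide (0 ≤ k)), digitsPos y k + k.natAbs - 1, walkStack k.natAbs s'⟩
      ⟨.back (decide (0 ≤ k)), G.markerPos (i + 1), walkStack k.natAbs s'⟩ :=
    runs_left (fun a Z ha => .back _ Z ha) (p := i + 1) hi (by omega)
      (by change _ < G.markerPos (i + 2); omega) _ s'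
  have h7 : walkAutomaton.Step G.encode
      ⟨.back (decide (0 ≤ k)), G.markerPos (i + 1), walkStack k.natAbs s'⟩
      ⟨.jump (decide (0 ≤ k)), G.markerPos (i + 1), walkStack k.natAbs s'⟩ :=
    step_keep (fun Z => .returned _ Z) (getElem?_markerPos_succ hi) (by simp)
      (markerPos_lt_length (by omega)) _ s'
  obtain ⟨d', h8⟩ := runs_jump (G := G) (d := decide (0 ≤ k)) (p := i + 1) (j := k.natAbs)
    (by omega) s'
  have hd' : ((scrollStep G.length)^[k.natAbs] (i + 1, decide (0 ≤ k))).1 = j + 1 := hd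
  rw [hd'] at h8
  have h9 : walkAutomaton.Step G.encode ⟨.jump d', G.markerPos (j + 1), walkStack 0 s'⟩
      ⟨.vertex, G.markerPos (j + 1), walkStack 0 s'⟩ := by
    obtain ⟨Z, rest, h'⟩ := List.exists_cons_of_ne_nil (walkStack_ne_nil 0 s')
    have hZ : Z ≠ .mark := by
      rintro rfl
      obtain ⟨_, h0, -⟩ := eq_succ_of_walkStack_eq_mark h'
      exact absurd h0.symm (Nat.succ_ne_zero _)
    rw [h']
    exact step (.arrived d' hZ) (getElem?_markerPos_succ hj) (by simp)
      (markerPos_lt_length (by omega)) rest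
  exact ((((((((h1.tail h2).tail h3).trans h4).tail h5).trans h6).tail h7).trans h8).tail h9)

lemma accepts_of_yesInstance (h : G.YesInstance) : walkAutomaton.Accepts G.encode := by
  obtain ⟨hn, h⟩ := h
  have hG : G ≠ [] := List.length_pos_iff.1 hn
  rw [dyckTwoReach_iff] at h
  have hpos : G.markerPos 1 = 1 := by simp [markerPos, RelGraph.encode]
  have hlen := G.length_codeTape
  have hone : 1 ≤ G.encode.length := by
    have h1 : G.markerPos 1 < G.markerPos 2 := markerPos_lt_succ hn
    have h2 := markerPos_le_of_le (G := G) (p := 2) (q := G.length + 1) (by omega) le_rfl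
    rw [markerPos_length] at h2
    simp only [hpos] at h1
    omega
  obtain ⟨f, hf, hacc⟩ := CheckState.exists_run_encode hG
  have h1 : walkAutomaton.Step G.encode ⟨.start, 0, walkStack 0 []⟩
      ⟨.check .first, 1, walkStack 0 []⟩ :=
    step_keep (fun Z => .start Z) rfl (by simp) (by change _ < G.codeTape.length; omega) 0 []
  have h2 := runs_check (w := G.encode) G.encode (u := []) rfl hf
  have h3 : walkAutomaton.Step G.encode ⟨.check f, G.encode.length + 1, walkStack 0 []⟩
      ⟨.rewind, G.encode.length, walkStack 0 []⟩ :=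
    step_keep (fun Z => .checked Z hacc) (TwoNPDA.getElem?_tape_last _) (by simp)
      (by change _ < G.codeTape.length; omega) 0 []
  have h4 := runs_rewind (w := G.encode) le_rfl
  have h5 : walkAutomaton.Step G.encode ⟨.rewind, 0, walkStack 0 []⟩
      ⟨.vertex, G.markerPos 1, walkStack 0 []⟩ :=
    step_keep (fun Z => .rewound Z) rfl (by simp [hpos])
      (by change _ < G.codeTape.length; omega) 0 []
  have h6 : ∀ c c' : Fin G.length × List Bool, Relation.ReflTransGen (StackStep G.Edge) c c' →
      Relation.ReflTransGen (walkAutomaton.Step G.encode)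
        ⟨.vertex, G.markerPos (c.1 + 1), walkStack 0 c.2⟩
        ⟨.vertex, G.markerPos (c'.1 + 1), walkStack 0 c'.2⟩ := by
    intro c c' h
    induction h with
    | refl => exact .refl
    | tail _ hs ih =>
      obtain ⟨b, ⟨k, hk, hd⟩, hb⟩ := hs
      obtain ⟨y, he⟩ := exists_edgeAt_of_mem (Fin.is_lt _) hk
      exact ih.trans (runs_edge he hb (Fin.is_lt _) hd)
  have h7 : walkAutomaton.Step G.encode
      ⟨.vertex, G.markerPos (G.length - 1 + 1), walkStack 0 []⟩
      ⟨.finish, G.markerPos G.length + 1, walkStack 0 []⟩ := by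
    have h8 := markerPos_lt_length (G := G) le_rfl
    have h9 := markerPos_lt_succ (le_refl G.length)
    have h10 := getElem?_markerPos_succ (G := G) (i := G.length - 1) (by omega)
    rw [Nat.sub_add_cancel hn] at h10 ⊢
    exact step_keep (fun Z => .finish Z) h10 (by simp)
      (by change _ < G.codeTape.length; omega) 0 []
  have h8 := runs_right (q := .finish) (fun a Z ha => .finishSkip Z ha) (le_refl G.length)
    (Nat.lt_succ_self _) (markerPos_lt_succ (le_refl G.length)) le_rfl 0 []
  rw [markerPos_length] at h8
  refine ⟨WalkState.finish, rfl, ?_⟩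
  exact (((((((Relation.ReflTransGen.single h1).trans h2).tail h3).trans h4).tail h5).trans
    (h6 _ _ h)).tail h7).trans h8

end Completeness

/-- The automaton recognizes the codes of yes-instances. -/
theorem language_walkAutomaton : walkAutomaton.language = relDyckTwoLanguage := by
  ext w
  constructor
  · intro h
    obtain ⟨G, rfl, hG⟩ := exists_eq_encode_of_accepts h
    exact ⟨G, rfl, yesInstance_of_accepts hG h⟩
  · rintro ⟨G, rfl, hG⟩
    exact accepts_of_yesInstance hG

end WalkAutomaton

theorem theorem5 :
    ∃ A₀ : TwoNPDA HardSym,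
      A₀.language = relDyckTwoLanguage ∧
      ∀ (α : Type) [Finite α] (A : TwoNPDA α),
        ∃ h : FreeMonoid α →* FreeMonoid HardSym,
          (∃ k : ℕ, ∀ w : List α, w ≠ [] →
            ∃ G : RelGraph, FreeMonoid.toList (h (FreeMonoid.ofList w)) = G.encode ∧
              G.Bounded (k * w.length) k) ∧
          ∀ w : List α, w ≠ [] →
            (w ∈ A.language ↔
              FreeMonoid.toList (h (FreeMonoid.ofList w)) ∈ A₀.language) := by
  refine ⟨walkAutomaton, WalkAutomaton.language_walkAutomaton, fun α _ A => ?_⟩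
  obtain ⟨N, T, hT⟩ := A.exists_bracket_program
  refine ⟨BracketProgram.encodeHom T, ⟨_, fun w _ => ⟨BracketProgram.graph T w,
    BracketProgram.toList_encodeHom w, BracketProgram.bounded_graph w⟩⟩, fun w hw => ?_⟩
  have hG : BracketProgram.graph T w ≠ [] := by
    rw [← List.length_pos_iff, BracketProgram.length_graph]
    exact Nat.mul_pos (List.length_pos_iff.2 hw) (by omega)
  rw [BracketProgram.toList_encodeHom]
  -- Both directions for the automaton are applied to the constructed graph itself, so it does not
  -- matter whether its code has another decoding.
  exact ((hT w).trans (BracketProgram.yesInstance_graph_iff hw).symm).trans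
    ⟨WalkAutomaton.accepts_of_yesInstance, WalkAutomaton.yesInstance_of_accepts hG⟩
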